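/- For $\tau>0$ let $\mathcal G_\tau$ be the class of probability distributions on $\mathbb R$ such that a random variable $\xi$ with this law satisfies $\mathbb E\xi=0$, $\operatorname{Var}(\xi)=1$ and $\mathbb E e^{t\xi}\le e^{\tau t^2}$ for all $t\in\mathbb R$. For a real matrix $A$, let $\sigma_1(A)\ge\sigma_2(A)\ge\cdots\ge 0$ be its singular values, $\|A\|=\sigma_1(A)$ its spectral norm and $\|A\|_F$ its Frobenius norm. For $V,W\in\mathbb R^{p\times r}$ with orthonormal columns, put $\sin\Theta(V,W)=\operatorname{diag}(\sin\theta_1,\dots,\sin\theta_r)$ with $\theta_k=\arccos\sigma_k(V^{\top}W)$. Theorem (Upper Bound). For every $\tau>0$ there is a constant $C>0$, depending only on $\tau$, such that the following holds for all $p_1,p_2\ge 1$ and $1\le r\le\min(p_1,p_2)$. Let $X\in\mathbb R^{p_1\times p_2}$ be a fixed matrix of rank $r$ with singular value decomposition $X=U\Sigma V^{\top}$, where $U\in\mathbb R^{p_1\times r}$ and $V\in\mathbb R^{p_2\times r}$ have orthonormal columns and $\Sigma=\operatorname{diag}(\sigma_1(X),\dots,\sigma_r(X))$. Let $Y=X+Z$,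 where the entries of $Z\in\mathbb R^{p_1\times p_2}$ are independent and identically distributed with a law in $\mathcal G_\tau$, and let the random matrices $\hat U$ and $\hat V$ consist of the first $r$ left and the first $r$ right singular vectors of $Y$, taken from any singular value decomposition of $Y$. Then $$\mathbb E\|\sin\Theta(V,\hat V)\|^2\le\frac{Cp_2(\sigma_r^2(X)+p_1)}{\sigma_r^4(X)}\wedge 1,\qquad \mathbb E\|\sin\Theta(V,\hat V)\|_F^2\le\frac{Cp_2r(\sigma_r^2(X)+p_1)}{\sigma_r^4(X)}\wedge r,$$ $$\mathbb E\|\sin\Theta(U,\hat U)\|^2\le\frac{Cp_1(\sigma_r^2(X)+p_2)}{\sigma_r^4(X)}\wedge 1,\qquad \mathbb E\|\sin\Theta(U,\hat U)\|_F^2\le\frac{Cp_1r(\sigma_r^2(X)+p_2)}{\sigma_r^4(X)}\wedge r,$$ where $a\wedge b=\min(a,b)$. -/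

import Mathlib

open MeasureTheory ProbabilityTheory
open scoped Matrix

namespace SingularSubspace

/-- The `k`-th largest singular value `σ_k(A)` of a real matrix, for `k = 1, 2, …`
(Mathlib counts singular values from `0`). It is `0` beyond the rank of `A`. -/
noncomputable def sigma {m n : ℕ} (A : Matrix (Fin m) (Fin n) ℝ) (k : ℕ) : ℝ :=
  (Matrix.toEuclideanLin A).singularValues (k - 1)

open scoped Matrix.Norms.L2Operator in
/-- The spectral norm: the operator norm with respect to the Euclidean norms. -/
noncomputable def specNorm {m n : ℕ} (A : Matrix (Fin m) (Fin n) ℝ) : ℝ := ‖A‖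

open scoped Matrix.Norms.Frobenius in
/-- The Frobenius norm. -/
noncomputable def frobNorm {m n : ℕ} (A : Matrix (Fin m) (Fin n) ℝ) : ℝ := ‖A‖

/-- The matrix `Θ(V, W) = diag(arccos σ₁, …, arccos σ_r)` of principal angles, where
`σ₁ ≥ ⋯ ≥ σ_r` are the singular values of `Vᵀ W`, is diagonal, and its sine is taken on the
diagonal. It is meant for `V` and `W` with orthonormal columns. -/
noncomputable def sinTheta {p r : ℕ} (V W : Matrix (Fin p) (Fin r) ℝ) :
    Matrix (Fin r) (Fin r) ℝ :=
  Matrix.diagonal fun k : Fin r => Real.sin (Real.arccos (sigma (Vᵀ * W) (k.val + 1)))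

/-- The rectangular matrix with `σ₁(A) ≥ σ₂(A) ≥ ⋯` on its main diagonal and `0` elsewhere. -/
noncomputable def sigmaMatrix {m n : ℕ} (A : Matrix (Fin m) (Fin n) ℝ) :
    Matrix (Fin m) (Fin n) ℝ :=
  Matrix.of fun i j => if i.val = j.val then sigma A (i.val + 1) else 0

/-- `U` and `V` hold the first `r` left and right singular vectors of `A` in some singular value
decomposition `A = U₀ Σ V₀ᵀ` with singular values in descending order (the decomposition need
not be unique). -/
def IsLeadingSingularVectors {m n r : ℕ} (A : Matrix (Fin m) (Fin n) ℝ)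
    (U : Matrix (Fin m) (Fin r) ℝ) (V : Matrix (Fin n) (Fin r) ℝ) : Prop :=
  ∃ (hm : r ≤ m) (hn : r ≤ n), ∃ U₀ ∈ Matrix.orthogonalGroup (Fin m) ℝ,
    ∃ V₀ ∈ Matrix.orthogonalGroup (Fin n) ℝ,
      A = U₀ * sigmaMatrix A * V₀ᵀ ∧
      U = U₀.submatrix id (Fin.castLE hm) ∧ V = V₀.submatrix id (Fin.castLE hn)

/-- The class `𝒢_τ` of sub-Gaussian distributions on `ℝ` with mean `0` and variance `1`. -/
structure IsStdSubGaussian (τ : ℝ) (ν : Measure ℝ) : Prop where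
  isProbabilityMeasure : IsProbabilityMeasure ν
  mean_eq : ∫ x, x ∂ν = 0
  variance_eq : Var[fun x => x; ν] = 1
  integrable_exp : ∀ t : ℝ, Integrable (fun x => Real.exp (t * x)) ν
  exp_le : ∀ t : ℝ, ∫ x, Real.exp (t * x) ∂ν ≤ Real.exp (τ * t ^ 2)

end SingularSubspace

open SingularSubspace

/-!
Write `Y = X + Z` with `X` of size `m × n`. The quantity `sin Θ(V, V̂)` has the same norms as the
part `V̂ - V Vᵀ V̂` of `V̂` orthogonal to the columns of `V` (`exists_basis_sin`), so the task is to
bound the latter. Only two features of the noise matter: `α = ‖Uᵀ Z‖`, the noise compressed to the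
column space of `X`, and `δ = ‖Zᵀ Z - m I‖`, the deviation of the noise Gram matrix from its mean.

The deterministic part (`norm_proj_le`, `norm_sub_proj_le`) is the inequality
`‖sin Θ(V, V̂)‖² ≤ 64 (α² (σ² + m) + δ²) / σ⁴`, where `σ` is the smallest positive singular value of
`X`. It is trivial unless `α ≤ σ / 8` and `δ ≤ σ² / 8`. In that case every vector of the signal space
satisfies `‖Y a‖² ≥ (m + σ² / 2) ‖a‖²`, hence so do the top `r` eigenvalues of `Yᵀ Y`. A vector `w`
of the leading right singular space is `w = Yᵀ Y w'` with `w'` in the same space, and for its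
component `q` orthogonal to `V` one has `X q = 0`, so
`‖q‖² = ⟪Z q, Y w'⟫ = ⟪Z q, X w'⟫ + ⟪(Zᵀ Z - m I) q, w'⟫ + m ⟪q, w'⟫`. The first two terms are
controlled by `α` and `δ`. The third has size `m ‖q‖ ‖q'‖`, where `q'` is the component of `w'`
orthogonal to `V`, and is absorbed on the left because the eigenvalues exceed `m` by `σ² / 2`.
The largest singular value of `X` never enters.

The probabilistic part is the pair of mean-square bounds `E α² ≲ n` and `E δ² ≲ n² + m n`
(`exists_dominating_compression`, `exists_dominating_covariance`). Both follow from `1/2`-nets of at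
most `5 ^ n` points, exponential moments of the forms `⟪U y, Z x⟫` and `‖Z x‖² - m ‖x‖²`, and a
maximal inequality. Because the deterministic inequality holds without any smallness assumption,
taking expectations in it is enough: no exceptional event has to be treated. The term `n²` is
harmless when `n ≤ σ²`, and otherwise the claimed bound exceeds `1`.

The statement about left singular vectors is the one about right singular vectors for `Yᵀ`.
-/

namespace SingularSubspace

open scoped RealInnerProductSpace

/-! ### Exponential moments of squares and a maximal inequality -/

section Concentration

variable {Ω : Type*} [MeasurableSpace Ω] {μ : Measure Ω} [IsProbabilityMeasure μ]

theorem exp_le_one_add_add_sq_mul_exp_abs (x : ℝ) :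
    Real.exp x ≤ 1 + x + x ^ 2 * Real.exp |x| := by
  have h1 : 1 ≤ Real.exp |x| := Real.one_le_exp (abs_nonneg x)
  rcases le_total |x| 1 with h | h
  · have := (abs_le.1 (Real.abs_exp_sub_one_sub_id_le h)).2
    nlinarith [sq_nonneg x]
  · have h2 : |x| ≤ x ^ 2 := by rw [← sq_abs]; nlinarith
    rcases le_total 0 x with hx | hx
    · rw [abs_of_nonneg hx] at *
      nlinarith [Real.exp_pos x]
    · have h3 : Real.exp x ≤ 1 := Real.exp_le_one_iff.2 hx
      rw [abs_of_nonpos hx] at h1 h2 ⊢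
      nlinarith

theorem sq_mul_exp_le {c x : ℝ} (hc : 0 < c) (hx : 0 ≤ x) :
    x ^ 2 * Real.exp (c * x) ≤ 2 / c ^ 2 * Real.exp (2 * c * x) := by
  have h := Real.quadratic_le_exp_of_nonneg (mul_nonneg hc.le hx)
  have h2 : x ^ 2 ≤ 2 / c ^ 2 * Real.exp (c * x) := by
    rw [div_mul_eq_mul_div, le_div_iff₀ (by positivity)]
    nlinarith [mul_nonneg hc.le hx]
  calc _ ≤ 2 / c ^ 2 * Real.exp (c * x) * Real.exp (c * x) := by gcongr
    _ = _ := by rw [mul_assoc, ← Real.exp_add]; ring_nf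

/-- The square of a sub-Gaussian variable has an exponential moment. The proof linearizes the
square by a Gaussian integral, `exp (a ^ 2) = π ^ (-1/2) ∫ exp (2 a g - g ^ 2) dg`, and integrates
over the variable first. -/
theorem integrable_exp_sq_and_le {η : Ω → ℝ} (hη : AEMeasurable η μ) {κ : ℝ} (hκ : 0 < κ)
    (hint : ∀ t : ℝ, Integrable (fun ω => Real.exp (t * η ω)) μ)
    (hle : ∀ t : ℝ, ∫ ω, Real.exp (t * η ω) ∂μ ≤ Real.exp (κ * t ^ 2)) :
    Integrable (fun ω => Real.exp (η ω ^ 2 / (8 * κ))) μ ∧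
      ∫ ω, Real.exp (η ω ^ 2 / (8 * κ)) ∂μ ≤ 2 := by
  set s := √(8 * κ) with hs
  have hs0 : 0 < s := Real.sqrt_pos.2 (by positivity)
  have hs2 : s ^ 2 = 8 * κ := Real.sq_sqrt (by positivity)
  have hpi : 0 < √Real.pi := Real.sqrt_pos.2 Real.pi_pos
  have hgauss : ∀ a : ℝ, Integrable (fun g : ℝ => Real.exp (2 * a * g - g ^ 2)) ∧
      ∫ g : ℝ, Real.exp (2 * a * g - g ^ 2) = √Real.pi * Real.exp (a ^ 2) := by
    intro a
    have e : (fun g : ℝ => Real.exp (2 * a * g - g ^ 2)) =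
        fun g => Real.exp (a ^ 2) * (fun x => Real.exp (-1 * x ^ 2)) (g - a) := by
      funext g; simp only; rw [← Real.exp_add]; ring_nf
    rw [e]
    constructor
    · exact ((integrable_exp_neg_mul_sq one_pos).comp_sub_right a).const_mul _
    · rw [integral_const_mul, integral_sub_right_eq_self (fun x => Real.exp (-1 * x ^ 2)) a,
        integral_gaussian]
      simp [mul_comm]
  have key : ∫⁻ ω, ENNReal.ofReal (Real.exp (η ω ^ 2 / (8 * κ))) ∂μ ≤ ENNReal.ofReal 2 := by
    have h1 : ∀ ω, ENNReal.ofReal (Real.exp (η ω ^ 2 / (8 * κ))) =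
        ∫⁻ g : ℝ, ENNReal.ofReal (Real.exp (2 * (η ω / s) * g - g ^ 2) / √Real.pi) := by
      intro ω
      rw [← ofReal_integral_eq_lintegral_ofReal ((hgauss _).1.div_const _)
        (Filter.Eventually.of_forall fun g => by positivity), integral_div, (hgauss _).2,
        mul_div_cancel_left₀ _ hpi.ne', div_pow, hs2]
    simp_rw [h1]
    rw [lintegral_lintegral_swap]
    swap
    · have h2 : AEMeasurable (fun p : Ω × ℝ => η p.1) (μ.prod volume) :=
        hη.comp_quasiMeasurePreserving Measure.quasiMeasurePreserving_fst
      simp only [Function.uncurry_def]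
      fun_prop
    have h3 : ∀ g : ℝ, ∫⁻ ω, ENNReal.ofReal
        (Real.exp (2 * (η ω / s) * g - g ^ 2) / √Real.pi) ∂μ ≤
        ENNReal.ofReal (Real.exp (-(1 / 2) * g ^ 2) / √Real.pi) := by
      intro g
      have e : ∀ ω, Real.exp (2 * (η ω / s) * g - g ^ 2) / √Real.pi =
          Real.exp ((2 * g / s) * η ω) * (Real.exp (-g ^ 2) / √Real.pi) := by
        intro ω
        rw [← mul_div_assoc (Real.exp _), ← Real.exp_add]; ring_nf
      simp_rw [e]
      rw [← ofReal_integral_eq_lintegral_ofReal ((hint _).mul_const _)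
        (Filter.Eventually.of_forall fun g => by positivity), integral_mul_const]
      apply ENNReal.ofReal_le_ofReal
      calc _ ≤ Real.exp (κ * (2 * g / s) ^ 2) * (Real.exp (-g ^ 2) / √Real.pi) := by
            gcongr; exact hle _
        _ = _ := by
            rw [← mul_div_assoc (Real.exp _), ← Real.exp_add, div_pow, hs2]
            congr 2
            field_simp
            ring
    refine (lintegral_mono h3).trans ?_
    rw [← ofReal_integral_eq_lintegral_ofReal
      ((integrable_exp_neg_mul_sq (by norm_num : (0 : ℝ) < 1 / 2)).div_const _)
      (Filter.Eventually.of_forall fun g => by positivity), integral_div, integral_gaussian]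
    apply ENNReal.ofReal_le_ofReal
    rw [div_le_iff₀ hpi, Real.sqrt_le_left (by positivity), mul_pow, Real.sq_sqrt Real.pi_pos.le]
    linarith [Real.pi_pos]
  have hm : AEStronglyMeasurable (fun ω => Real.exp (η ω ^ 2 / (8 * κ))) μ := by
    have : AEMeasurable (fun ω => Real.exp (η ω ^ 2 / (8 * κ))) μ := by fun_prop
    exact this.aestronglyMeasurable
  have hI : Integrable (fun ω => Real.exp (η ω ^ 2 / (8 * κ))) μ := by
    refine ⟨hm, ?_⟩
    rw [hasFiniteIntegral_iff_ofReal (Filter.Eventually.of_forall fun g => by positivity)]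
    exact key.trans_lt ENNReal.ofReal_lt_top
  refine ⟨hI, ?_⟩
  rw [← ofReal_integral_eq_lintegral_ofReal hI
    (Filter.Eventually.of_forall fun g => by positivity)] at key
  exact (ENNReal.ofReal_le_ofReal_iff (by norm_num)).1 key

/-- The centred square of a sub-Gaussian variable is sub-exponential. -/
theorem integrable_exp_centred_sq_and_le {η : Ω → ℝ} (hη : AEMeasurable η μ) {κ : ℝ} (hκ : 0 < κ)
    (hint : ∀ t : ℝ, Integrable (fun ω => Real.exp (t * η ω)) μ)
    (hle : ∀ t : ℝ, ∫ ω, Real.exp (t * η ω) ∂μ ≤ Real.exp (κ * t ^ 2))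
    {v c : ℝ} (hsq : Integrable (fun ω => η ω ^ 2) μ) (hv : ∫ ω, η ω ^ 2 ∂μ = v) (hv1 : v ≤ 1)
    (hc : c = 1 / (16 * κ)) {t : ℝ} (ht : |t| ≤ c) :
    Integrable (fun ω => Real.exp (t * (η ω ^ 2 - v))) μ ∧
      ∫ ω, Real.exp (t * (η ω ^ 2 - v)) ∂μ ≤
        Real.exp (4 * Real.exp (2 * c) / c ^ 2 * t ^ 2) := by
  obtain ⟨hI, hB⟩ := integrable_exp_sq_and_le hη hκ hint hle
  have hc0 : 0 < c := by rw [hc]; positivity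
  have hv0 : 0 ≤ v := hv ▸ integral_nonneg fun ω => sq_nonneg _
  have hpt : ∀ ω, Real.exp (t * (η ω ^ 2 - v)) ≤ 1 + t * (η ω ^ 2 - v) +
      t ^ 2 * (2 / c ^ 2 * Real.exp (2 * c)) * Real.exp (η ω ^ 2 / (8 * κ)) := by
    intro ω
    set y := η ω ^ 2 - v
    have hy : |y| ≤ η ω ^ 2 + 1 := by
      rw [abs_le]; constructor <;> simp only [y] <;> nlinarith [sq_nonneg (η ω)]
    have h1 := exp_le_one_add_add_sq_mul_exp_abs (t * y)
    have h2 : (t * y) ^ 2 * Real.exp |t * y| ≤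
        t ^ 2 * (2 / c ^ 2 * Real.exp (2 * c)) * Real.exp (η ω ^ 2 / (8 * κ)) := by
      calc (t * y) ^ 2 * Real.exp |t * y| ≤ t ^ 2 * (|y| ^ 2 * Real.exp (c * |y|)) := by
            rw [mul_pow, abs_mul, sq_abs, mul_assoc]; gcongr
        _ ≤ t ^ 2 * (2 / c ^ 2 * Real.exp (2 * c * |y|)) := by
            exact mul_le_mul_of_nonneg_left (sq_mul_exp_le hc0 (abs_nonneg _)) (sq_nonneg _)
        _ ≤ t ^ 2 * (2 / c ^ 2 * Real.exp (2 * c * (η ω ^ 2 + 1))) := by gcongr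
        _ = _ := by
            rw [show 2 * c * (η ω ^ 2 + 1) = 2 * c + η ω ^ 2 / (8 * κ) by
              rw [hc]; field_simp; ring, Real.exp_add]
            ring
    linarith
  have hlin : Integrable (fun ω => t * (η ω ^ 2 - v)) μ :=
    (hsq.sub (integrable_const _)).const_mul _
  have hlin' : Integrable (fun ω => 1 + t * (η ω ^ 2 - v)) μ := (integrable_const _).add hlin
  have hdom : Integrable (fun ω => 1 + t * (η ω ^ 2 - v) +
      t ^ 2 * (2 / c ^ 2 * Real.exp (2 * c)) * Real.exp (η ω ^ 2 / (8 * κ))) μ :=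
    hlin'.add (hI.const_mul _)
  have hint' : Integrable (fun ω => Real.exp (t * (η ω ^ 2 - v))) μ := by
    refine hdom.mono' ?_ (Filter.Eventually.of_forall fun ω => ?_)
    · have : AEMeasurable (fun ω => Real.exp (t * (η ω ^ 2 - v))) μ := by fun_prop
      exact this.aestronglyMeasurable
    · rw [Real.norm_of_nonneg (Real.exp_pos _).le]; exact hpt ω
  refine ⟨hint', (integral_mono hint' hdom hpt).trans ?_⟩
  rw [integral_add hlin' (hI.const_mul _), integral_add (integrable_const _) hlin,
      integral_const_mul, integral_const_mul,
      integral_sub hsq (integrable_const _), hv]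
  simp only [integral_const, probReal_univ, smul_eq_mul, one_mul, sub_self, mul_zero, add_zero]
  refine le_trans ?_ (Real.add_one_le_exp _)
  have : 0 ≤ t ^ 2 * (2 / c ^ 2 * Real.exp (2 * c)) := by positivity
  calc 1 + t ^ 2 * (2 / c ^ 2 * Real.exp (2 * c)) * ∫ ω, Real.exp (η ω ^ 2 / (8 * κ)) ∂μ
      ≤ 1 + t ^ 2 * (2 / c ^ 2 * Real.exp (2 * c)) * 2 := by gcongr
    _ = _ := by ring

/-- The elementary bound behind the maximal inequality: beyond a threshold `L`, a square is
dominated by an exponential. -/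
theorem sq_le_two_mul_sq_add_exp {y L : ℝ} (hy : 0 ≤ y) :
    y ^ 2 ≤ 2 * L ^ 2 + 4 * Real.exp (y - L) := by
  rcases le_total y L with h | h
  · nlinarith [Real.exp_pos (y - L)]
  · have := Real.quadratic_le_exp_of_nonneg (sub_nonneg.2 h)
    nlinarith [sq_nonneg (y - 2 * L)]

/-- A maximal inequality: the squares of finitely many variables with controlled exponential
moments at `± t` are dominated by a single variable of expectation `O(log² N / t²)`. -/
theorem exists_dominating_sq {ι : Type*} (s : Finset ι) (ξ : ι → Ω → ℝ) {t b L : ℝ} (ht : 0 < t)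
    (hint : ∀ i ∈ s, ∀ u : ℝ, |u| = t → Integrable (fun ω => Real.exp (u * ξ i ω)) μ)
    (hle : ∀ i ∈ s, ∀ u : ℝ, |u| = t → ∫ ω, Real.exp (u * ξ i ω) ∂μ ≤ Real.exp b)
    (hL : 2 * s.card * Real.exp b ≤ Real.exp L) :
    ∃ g : Ω → ℝ, Integrable g μ ∧ (∀ ω, 0 ≤ g ω) ∧ (∀ i ∈ s, ∀ ω, ξ i ω ^ 2 ≤ g ω) ∧
      ∫ ω, g ω ∂μ ≤ (2 * L ^ 2 + 4) / t ^ 2 := by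
  have hp : |t| = t := abs_of_pos ht
  have hn : |(-t)| = t := by rw [abs_neg, hp]
  have hi2 : ∀ i ∈ s, Integrable (fun ω => Real.exp (t * ξ i ω) + Real.exp (-t * ξ i ω)) μ :=
    fun i hi => (hint i hi t hp).add (hint i hi (-t) hn)
  set G : Ω → ℝ := fun ω => ∑ i ∈ s, (Real.exp (t * ξ i ω) + Real.exp (-t * ξ i ω)) with hG
  have hGi : Integrable G μ := integrable_finsetSum _ hi2
  have hG0 : ∀ ω, 0 ≤ G ω := fun ω => Finset.sum_nonneg fun i _ => by positivity
  refine ⟨fun ω => (2 * L ^ 2 + 4 * (Real.exp (-L) * G ω)) / t ^ 2, ?_, ?_, ?_, ?_⟩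
  · exact ((integrable_const _).add ((hGi.const_mul _).const_mul _)).div_const _
  · intro ω
    have := hG0 ω
    positivity
  · intro i hi ω
    rw [le_div_iff₀ (by positivity)]
    have h1 := sq_le_two_mul_sq_add_exp (L := L) (mul_nonneg ht.le (abs_nonneg (ξ i ω)))
    rw [mul_pow, sq_abs] at h1
    have h2 : Real.exp (t * |ξ i ω|) ≤ G ω := by
      have h3 : Real.exp (t * |ξ i ω|) ≤ Real.exp (t * ξ i ω) + Real.exp (-t * ξ i ω) := by
        rcases abs_cases (ξ i ω) with ⟨h, _⟩ | ⟨h, _⟩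
        · rw [h]; linarith [Real.exp_pos (-t * ξ i ω)]
        · rw [h, mul_neg, ← neg_mul]; linarith [Real.exp_pos (t * ξ i ω)]
      exact h3.trans (Finset.single_le_sum
        (f := fun i => Real.exp (t * ξ i ω) + Real.exp (-t * ξ i ω))
        (fun i _ => by positivity) hi)
    have h3 : Real.exp (t * |ξ i ω| - L) ≤ Real.exp (-L) * G ω := by
      rw [sub_eq_neg_add, Real.exp_add]; gcongr
    linarith
  · rw [integral_div, integral_add (integrable_const _) ((hGi.const_mul _).const_mul _),
      integral_const_mul 4, integral_const_mul (Real.exp (-L))]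
    simp only [integral_const, probReal_univ, smul_eq_mul, one_mul]
    gcongr
    have h1 : ∫ ω, G ω ∂μ ≤ Real.exp L := by
      rw [hG, integral_finsetSum _ hi2]
      calc _ ≤ ∑ i ∈ s, 2 * Real.exp b := by
            refine Finset.sum_le_sum fun i hi => ?_
            rw [integral_add (hint i hi t hp) (hint i hi (-t) hn)]
            linarith [hle i hi t hp, hle i hi (-t) hn]
        _ = 2 * s.card * Real.exp b := by rw [Finset.sum_const, nsmul_eq_mul]; ring
        _ ≤ _ := hL
    calc 4 * (Real.exp (-L) * ∫ ω, G ω ∂μ) ≤ 4 * (Real.exp (-L) * Real.exp L) := by gcongr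
      _ = 4 := by rw [← Real.exp_add]; simp

end Concentration

/-! ### Linear combinations of sub-Gaussian variables -/

section Sums

variable {Ω : Type*} [MeasurableSpace Ω] {μ : Measure Ω}
variable {ν : Measure ℝ} {τ : ℝ}

theorem IsStdSubGaussian.integrable_exp_comp (hν : IsStdSubGaussian τ ν) {X : Ω → ℝ}
    (hX : HasLaw X ν μ) (t : ℝ) : Integrable (fun ω => Real.exp (t * X ω)) μ := by
  have h := hν.integrable_exp t
  rw [← hX.map_eq, integrable_map_measure (by fun_prop) hX.aemeasurable] at h
  exact h

theorem IsStdSubGaussian.mgf_le (hν : IsStdSubGaussian τ ν) {X : Ω → ℝ}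
    (hX : HasLaw X ν μ) (t : ℝ) : mgf X μ t ≤ Real.exp (τ * t ^ 2) := by
  have h := hX.integral_comp (f := fun x => Real.exp (t * x)) (by fun_prop)
  exact h.le.trans (hν.exp_le t)

theorem memLp_two_of_integrable_exp {η : Ω → ℝ}
    (hint : ∀ t : ℝ, Integrable (fun ω => Real.exp (t * η ω)) μ) : MemLp η 2 μ := by
  refine memLp_of_mem_interior_integrableExpSet (p := 2) ?_
  have : integrableExpSet η μ = Set.univ := Set.eq_univ_of_forall hint
  simp [this]

variable [IsProbabilityMeasure μ] {ι : Type*} [Fintype ι] {X : ι → Ω → ℝ}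

/-- Linear combinations of independent sub-Gaussian variables with coefficients in the unit ball
are sub-Gaussian with the same constant. -/
theorem IsStdSubGaussian.linearCombination (hτ : 0 < τ) (hν : IsStdSubGaussian τ ν)
    (hX : ∀ i, HasLaw (X i) ν μ) (hind : iIndepFun X μ) (c : ι → ℝ) (hc : ∑ i, c i ^ 2 ≤ 1)
    (t : ℝ) :
    Integrable (fun ω => Real.exp (t * ∑ i, c i * X i ω)) μ ∧
      ∫ ω, Real.exp (t * ∑ i, c i * X i ω) ∂μ ≤ Real.exp (τ * t ^ 2) := by
  have hind' : iIndepFun (fun i ω => c i * X i ω) μ :=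
    hind.comp (fun i x => c i * x) fun i => by fun_prop
  have hm : ∀ i, AEMeasurable (fun ω => c i * X i ω) μ := fun i =>
    (hX i).aemeasurable.const_mul _
  have hs := hind'.mgf_sum₀ hm Finset.univ (t := t)
  have he : (∑ i, fun ω => c i * X i ω) = fun ω => ∑ i, c i * X i ω := by
    funext ω; simp
  rw [he] at hs
  have hmgf : ∀ i, mgf (fun ω => c i * X i ω) μ t = mgf (X i) μ (t * c i) := fun i => by
    simp only [mgf, mul_assoc]
  have hle : mgf (fun ω => ∑ i, c i * X i ω) μ t ≤ Real.exp (τ * t ^ 2) := by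
    rw [hs]
    calc ∏ i, mgf (fun ω => c i * X i ω) μ t ≤ ∏ i, Real.exp (τ * (t * c i) ^ 2) := by
          refine Finset.prod_le_prod (fun i _ => mgf_nonneg) fun i _ => ?_
          rw [hmgf]
          exact hν.mgf_le (hX i) _
      _ = Real.exp (τ * t ^ 2 * ∑ i, c i ^ 2) := by
          rw [← Real.exp_sum, Finset.mul_sum]; congr 1
          exact Finset.sum_congr rfl fun i _ => by ring
      _ ≤ Real.exp (τ * t ^ 2) := by
          exact Real.exp_le_exp.2 (mul_le_of_le_one_right (by positivity) hc)
  refine ⟨?_, hle⟩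
  -- The moment generating function of a non-integrable exponential is `0`, but the product is
  -- positive.
  by_contra hcon
  have h0 := mgf_undef hcon
  rw [hs] at h0
  have : 0 < ∏ i, mgf (fun ω => c i * X i ω) μ t := Finset.prod_pos fun i _ => by
    rw [hmgf]; exact mgf_pos (hν.integrable_exp_comp (hX i) _)
  exact this.ne' h0

theorem IsStdSubGaussian.integral_linearCombination_sq (hν : IsStdSubGaussian τ ν)
    (hX : ∀ i, HasLaw (X i) ν μ) (hind : iIndepFun X μ) (c : ι → ℝ) :
    Integrable (fun ω => (∑ i, c i * X i ω) ^ 2) μ ∧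
      ∫ ω, (∑ i, c i * X i ω) ^ 2 ∂μ = ∑ i, c i ^ 2 := by
  have hL : ∀ i, MemLp (X i) 2 μ := fun i =>
    memLp_two_of_integrable_exp (hν.integrable_exp_comp (hX i))
  have hL' : ∀ i, MemLp (fun ω => c i * X i ω) 2 μ := fun i => (hL i).const_mul _
  have hLs : MemLp (fun ω => ∑ i, c i * X i ω) 2 μ :=
    memLp_finsetSum Finset.univ fun i _ => hL' i
  have hmean : ∀ i, ∫ ω, X i ω ∂μ = 0 := fun i => (hX i).integral_eq.trans hν.mean_eq
  have hms : ∫ ω, ∑ i, c i * X i ω ∂μ = 0 := by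
    rw [integral_finsetSum _ fun i _ => (hL' i).integrable (by norm_num)]
    exact Finset.sum_eq_zero fun i _ => by rw [integral_const_mul, hmean, mul_zero]
  refine ⟨hLs.integrable_sq, ?_⟩
  have hv := IndepFun.variance_sum (s := Finset.univ) (fun i _ => hL' i)
    (fun i _ j _ hij => (hind.indepFun hij).comp (φ := fun x => c i * x) (ψ := fun x => c j * x)
      (by fun_prop) (by fun_prop))
  have he : (∑ i, fun ω => c i * X i ω) = fun ω => ∑ i, c i * X i ω := by
    funext ω; simp
  rw [he, variance_eq_sub hLs, hms] at hv
  have hvar : ∀ i, Var[X i; μ] = 1 := fun i => (hX i).variance_eq.trans hν.variance_eq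
  simp only [variance_const_mul, hvar, mul_one] at hv
  simpa using hv

end Sums

/-! ### Bilinear and quadratic forms of the noise matrix -/

section Rows

variable {Ω : Type*} [MeasurableSpace Ω] {μ : Measure Ω} [IsProbabilityMeasure μ]

/-- Exponential moments of a sum of functions of the rows of an array of independent variables. -/
theorem integrable_exp_sum_rows_and_le {m n : ℕ} {Z : Fin m → Fin n → Ω → ℝ}
    (hZ : ∀ i j, AEMeasurable (Z i j) μ)
    (hind : iIndepFun (fun ij : Fin m × Fin n => Z ij.1 ij.2) μ)
    {g : (Fin n → ℝ) → ℝ} (hg : Measurable g) {t B : ℝ}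
    (hint : ∀ i, Integrable (fun ω => Real.exp (t * g fun j => Z i j ω)) μ)
    (hle : ∀ i, ∫ ω, Real.exp (t * g fun j => Z i j ω) ∂μ ≤ B) (S : Finset (Fin m)) :
    Integrable (fun ω => Real.exp (t * ∑ i ∈ S, g fun j => Z i j ω)) μ ∧
      ∫ ω, Real.exp (t * ∑ i ∈ S, g fun j => Z i j ω) ∂μ ≤ B ^ S.card := by
  induction S using Finset.induction_on with
  | empty => simp
  | insert i S hi ih =>
    have hI : IndepFun (fun ω => Real.exp (t * g fun j => Z i j ω))
        (fun ω => Real.exp (t * ∑ k ∈ S, g fun j => Z k j ω)) μ := by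
      have hd : Disjoint (({i} : Finset (Fin m)) ×ˢ (Finset.univ : Finset (Fin n)))
          (S ×ˢ (Finset.univ : Finset (Fin n))) := by
        rw [Finset.disjoint_left]
        rintro ⟨a, b⟩ h1 h2
        simp only [Finset.mem_product, Finset.mem_singleton, Finset.mem_univ, and_true] at h1 h2
        exact hi (h1 ▸ h2)
      have h := hind.indepFun_finset₀ _ _ hd fun ij => hZ ij.1 ij.2
      let φ : ((({i} : Finset (Fin m)) ×ˢ (Finset.univ : Finset (Fin n)) :
          Finset (Fin m × Fin n)) → ℝ) → ℝ :=
        fun x => Real.exp (t * g fun j => x ⟨(i, j), by simp⟩)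
      let ψ : ((S ×ˢ (Finset.univ : Finset (Fin n)) : Finset (Fin m × Fin n)) → ℝ) → ℝ :=
        fun x => Real.exp (t * ∑ k ∈ S.attach, g fun j => x ⟨(k.1, j), by simp⟩)
      have h2 := h.comp (φ := φ) (ψ := ψ) (by fun_prop) (by fun_prop)
      convert h2 using 1
      · rfl
      funext ω
      simp only [Function.comp, ψ]
      rw [Finset.sum_attach S fun k => g fun j => Z k j ω]
    have he : (fun ω => Real.exp (t * ∑ k ∈ insert i S, g fun j => Z k j ω)) =
        fun ω => Real.exp (t * g fun j => Z i j ω) *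
          Real.exp (t * ∑ k ∈ S, g fun j => Z k j ω) := by
      funext ω
      rw [Finset.sum_insert hi, mul_add, Real.exp_add]
    rw [he]
    refine ⟨hI.integrable_mul (hint i) ih.1, ?_⟩
    rw [hI.integral_fun_mul_eq_mul_integral (hint i).aestronglyMeasurable
      ih.1.aestronglyMeasurable, Finset.card_insert_of_notMem hi, pow_succ']
    have h0 : 0 ≤ ∫ ω, Real.exp (t * g fun j => Z i j ω) ∂μ :=
      integral_nonneg fun ω => (Real.exp_pos _).le
    exact mul_le_mul (hle i) ih.2 (integral_nonneg fun ω => (Real.exp_pos _).le)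
      (h0.trans (hle i))

variable {ν : Measure ℝ} {τ : ℝ} {m n : ℕ} {Z : Fin m → Fin n → Ω → ℝ}

theorem IsStdSubGaussian.bilinear (hτ : 0 < τ) (hν : IsStdSubGaussian τ ν)
    (hZ : ∀ i j, HasLaw (Z i j) ν μ)
    (hind : iIndepFun (fun ij : Fin m × Fin n => Z ij.1 ij.2) μ)
    (u : Fin m → ℝ) (x : Fin n → ℝ) (hu : ∑ i, u i ^ 2 ≤ 1) (hx : ∑ j, x j ^ 2 ≤ 1) (t : ℝ) :
    Integrable (fun ω => Real.exp (t * ∑ i, u i * ∑ j, Z i j ω * x j)) μ ∧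
      ∫ ω, Real.exp (t * ∑ i, u i * ∑ j, Z i j ω * x j) ∂μ ≤ Real.exp (τ * t ^ 2) := by
  have he : ∀ ω, ∑ i, u i * ∑ j, Z i j ω * x j =
      ∑ ij : Fin m × Fin n, (u ij.1 * x ij.2) * Z ij.1 ij.2 ω := fun ω => by
    rw [Fintype.sum_prod_type]
    exact Finset.sum_congr rfl fun i _ => by
      rw [Finset.mul_sum]; exact Finset.sum_congr rfl fun j _ => by ring
  simp_rw [he]
  refine hν.linearCombination hτ (X := fun ij : Fin m × Fin n => Z ij.1 ij.2)
    (fun ij => hZ ij.1 ij.2) hind (fun ij => u ij.1 * x ij.2) ?_ t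
  rw [Fintype.sum_prod_type]
  simp_rw [mul_pow, ← Finset.mul_sum, ← Finset.sum_mul]
  exact mul_le_one₀ hu (Finset.sum_nonneg fun j _ => sq_nonneg _) hx

/-- The centred quadratic form `‖Z x‖² - m ‖x‖²`, for `x` in the unit ball, is sub-exponential
with variance proxy of order `m`. -/
theorem IsStdSubGaussian.quadratic (hτ : 0 < τ) (hν : IsStdSubGaussian τ ν)
    (hZ : ∀ i j, HasLaw (Z i j) ν μ)
    (hind : iIndepFun (fun ij : Fin m × Fin n => Z ij.1 ij.2) μ)
    (x : Fin n → ℝ) (hx : ∑ j, x j ^ 2 ≤ 1) {c t : ℝ} (hc : c = 1 / (16 * τ)) (ht : |t| ≤ c) :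
    Integrable (fun ω => Real.exp (t * (∑ i, (∑ j, Z i j ω * x j) ^ 2 - m * ∑ j, x j ^ 2))) μ ∧
      ∫ ω, Real.exp (t * (∑ i, (∑ j, Z i j ω * x j) ^ 2 - m * ∑ j, x j ^ 2)) ∂μ ≤
        Real.exp (4 * Real.exp (2 * c) / c ^ 2 * m * t ^ 2) := by
  have hrow : ∀ i, iIndepFun (fun j => Z i j) μ := fun i =>
    hind.precomp (g := fun j => (i, j)) fun a b h => (Prod.mk.inj h).2
  have hswap : ∀ i ω, ∑ j, Z i j ω * x j = ∑ j, x j * Z i j ω := fun i ω =>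
    Finset.sum_congr rfl fun j _ => mul_comm _ _
  have h1 : ∀ i, Integrable (fun ω => Real.exp (t * ((∑ j, Z i j ω * x j) ^ 2 - ∑ j, x j ^ 2))) μ ∧
      ∫ ω, Real.exp (t * ((∑ j, Z i j ω * x j) ^ 2 - ∑ j, x j ^ 2)) ∂μ ≤
        Real.exp (4 * Real.exp (2 * c) / c ^ 2 * t ^ 2) := by
    intro i
    have hl := hν.linearCombination hτ (hZ i) (hrow i) x hx
    have hs := hν.integral_linearCombination_sq (hZ i) (hrow i) x
    simp_rw [hswap]
    refine integrable_exp_centred_sq_and_le ?_ hτ (fun t => (hl t).1) (fun t => (hl t).2) hs.1 hs.2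
      hx hc ht
    exact Finset.aemeasurable_fun_sum _ fun j _ => (hZ i j).aemeasurable.const_mul _
  have h2 := integrable_exp_sum_rows_and_le (fun i j => (hZ i j).aemeasurable) hind
    (g := fun y => (∑ j, y j * x j) ^ 2 - ∑ j, x j ^ 2) (by fun_prop)
    (fun i => (h1 i).1) (fun i => (h1 i).2) Finset.univ
  simp only [Finset.sum_sub_distrib, Finset.sum_const, Finset.card_univ, Fintype.card_fin,
    nsmul_eq_mul] at h2
  rw [← Real.exp_nat_mul] at h2
  convert h2 using 3
  ring

end Rows

/-! ### Nets of the unit ball -/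

section Nets

/-- The unit ball of an `n`-dimensional space has a `1/2`-net with at most `5 ^ n` points. -/
theorem exists_net (E : Type*) [NormedAddCommGroup E] [NormedSpace ℝ E] [FiniteDimensional ℝ E] :
    ∃ N : Finset E, N.card ≤ 5 ^ Module.finrank ℝ E ∧ (∀ y ∈ N, ‖y‖ ≤ 1) ∧
      ∀ x : E, ‖x‖ ≤ 1 → ∃ y ∈ N, ‖x - y‖ ≤ 1 / 2 := by
  classical
  -- A `1/2`-separated subset of the unit ball of maximal cardinality is a net.
  let P : Finset E → Prop := fun s => (∀ y ∈ s, ‖y‖ ≤ 1) ∧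
    ∀ c ∈ s, ∀ d ∈ s, c ≠ d → 1 / 2 ≤ ‖c - d‖
  have hcard : ∀ s, P s → s.card ≤ 5 ^ Module.finrank ℝ E := by
    intro s hs
    have hinj : Function.Injective fun x : E => (2 : ℝ) • x :=
      smul_right_injective E two_ne_zero
    have := Besicovitch.card_le_of_separated (s.image fun x => (2 : ℝ) • x) ?_ ?_
    · rwa [Finset.card_image_of_injective _ hinj] at this
    · intro c hc
      obtain ⟨x, hx, rfl⟩ := Finset.mem_image.1 hc
      rw [norm_smul, Real.norm_ofNat]
      linarith [hs.1 x hx]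
    · intro c hc d hd hcd
      obtain ⟨x, hx, rfl⟩ := Finset.mem_image.1 hc
      obtain ⟨y, hy, rfl⟩ := Finset.mem_image.1 hd
      rw [← smul_sub, norm_smul, Real.norm_ofNat]
      linarith [hs.2 x hx y hy fun h => hcd (by rw [h])]
  let K : Set ℕ := {k | ∃ s, P s ∧ s.card = k}
  have hK0 : K.Nonempty := ⟨0, ∅, ⟨by simp, by simp⟩, rfl⟩
  have hKb : BddAbove K := ⟨_, fun k ⟨s, hs, hk⟩ => hk ▸ hcard s hs⟩
  obtain ⟨s, hs, hsK⟩ := Nat.sSup_mem hK0 hKb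
  refine ⟨s, hcard s hs, hs.1, fun x hx => ?_⟩
  by_contra! hcon
  have hxs : x ∉ s := fun h => by
    have := hcon x h
    simp only [sub_self, norm_zero] at this
    linarith
  have hP : P (insert x s) := by
    refine ⟨fun y hy => ?_, fun c hc d hd hcd => ?_⟩
    · rcases Finset.mem_insert.1 hy with rfl | h
      exacts [hx, hs.1 y h]
    · rcases Finset.mem_insert.1 hc with rfl | hc' <;> rcases Finset.mem_insert.1 hd with rfl | hd'
      · exact absurd rfl hcd
      · exact (hcon d hd').le
      · rw [norm_sub_rev]; exact (hcon c hc').le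
      · exact hs.2 c hc' d hd' hcd
  have := le_csSup hKb (show (insert x s).card ∈ K from ⟨_, hP, rfl⟩)
  rw [Finset.card_insert_of_notMem hxs, ← hsK] at this
  omega

variable {E F : Type*} [NormedAddCommGroup E] [NormedSpace ℝ E] [FiniteDimensional ℝ E]
  [NormedAddCommGroup F] [NormedSpace ℝ F] [FiniteDimensional ℝ F]

theorem abs_le_of_net {N : Finset E} (hN : ∀ x : E, ‖x‖ ≤ 1 → ∃ y ∈ N, ‖x - y‖ ≤ 1 / 2)
    (f : E →ₗ[ℝ] ℝ) {M : ℝ} (hM : ∀ y ∈ N, |f y| ≤ M) (x : E) : |f x| ≤ 2 * M * ‖x‖ := by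
  obtain ⟨y₀, hy₀, -⟩ := hN 0 (by simp)
  have hM0 : 0 ≤ M := (abs_nonneg _).trans (hM y₀ hy₀)
  set g := LinearMap.toContinuousLinearMap f with hg
  have hgf : ∀ x, g x = f x := fun x => rfl
  have h1 : ‖g‖ ≤ M + ‖g‖ / 2 := by
    refine ContinuousLinearMap.opNorm_le_of_unit_norm (by positivity) fun x hx => ?_
    obtain ⟨y, hy, hxy⟩ := hN x hx.le
    have h2 : g x = g y + g (x - y) := by rw [← map_add]; simp
    have h3 := g.le_opNorm (x - y)
    calc ‖g x‖ ≤ ‖g y‖ + ‖g (x - y)‖ := h2 ▸ norm_add_le _ _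
      _ ≤ M + ‖g‖ * ‖x - y‖ := add_le_add (hM y hy) h3
      _ ≤ M + ‖g‖ / 2 := by nlinarith [norm_nonneg g]
  calc |f x| = ‖g x‖ := rfl
    _ ≤ ‖g‖ * ‖x‖ := g.le_opNorm x
    _ ≤ 2 * M * ‖x‖ := by gcongr; linarith

/-- A bilinear form bounded by `M` on `1/2`-nets has norm at most `4 M`. -/
theorem abs_le_of_nets {N : Finset E} (hN : ∀ x : E, ‖x‖ ≤ 1 → ∃ y ∈ N, ‖x - y‖ ≤ 1 / 2)
    {N' : Finset F} (hN' : ∀ x : F, ‖x‖ ≤ 1 → ∃ y ∈ N', ‖x - y‖ ≤ 1 / 2)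
    (f : E →ₗ[ℝ] F →ₗ[ℝ] ℝ) {M : ℝ} (hM : ∀ x ∈ N, ∀ y ∈ N', |f x y| ≤ M) (x : E) (y : F) :
    |f x y| ≤ 4 * M * ‖x‖ * ‖y‖ := by
  have h1 : ∀ z ∈ N, |f.flip y z| ≤ 2 * M * ‖y‖ := fun z hz =>
    abs_le_of_net hN' (f z) (hM z hz) y
  calc |f x y| ≤ 2 * (2 * M * ‖y‖) * ‖x‖ := abs_le_of_net hN (f.flip y) h1 x
    _ = _ := by ring

end Nets

/-! ### Mean-square bounds for random matrices -/

section RandomMatrix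

/-- The linear map between Euclidean spaces given by the random array `Z` at `ω`. -/
noncomputable def randomMap {Ω : Type*} {m n : ℕ} (Z : Fin m → Fin n → Ω → ℝ) (ω : Ω) :
    EuclideanSpace ℝ (Fin n) →ₗ[ℝ] EuclideanSpace ℝ (Fin m) :=
  Matrix.toEuclideanLin (Matrix.of fun i j => Z i j ω)

theorem randomMap_apply {Ω : Type*} {m n : ℕ} {Z : Fin m → Fin n → Ω → ℝ} (ω : Ω) (x : EuclideanSpace ℝ (Fin n)) (i : Fin m) :
    randomMap Z ω x i = ∑ j, Z i j ω * x j := by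
  simp [randomMap, Matrix.toLpLin_apply, Matrix.mulVec, dotProduct]

variable {Ω : Type*} [MeasurableSpace Ω] {μ : Measure Ω} [IsProbabilityMeasure μ]
  {ν : Measure ℝ} {τ : ℝ} {m n : ℕ} {Z : Fin m → Fin n → Ω → ℝ}

/-- The noise compressed to a fixed `r`-dimensional subspace of the target has operator norm
`O(√n)` in mean square, for `r ≤ n`. -/
theorem exists_dominating_compression (hτ : 0 < τ) (hν : IsStdSubGaussian τ ν)
    (hZ : ∀ i j, HasLaw (Z i j) ν μ)
    (hind : iIndepFun (fun ij : Fin m × Fin n => Z ij.1 ij.2) μ) {r : ℕ} (hn : 1 ≤ n) (hr : r ≤ n)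
    (u : EuclideanSpace ℝ (Fin r) →ₗᵢ[ℝ] EuclideanSpace ℝ (Fin m)) :
    ∃ g : Ω → ℝ, Integrable g μ ∧ (∀ ω, 0 ≤ g ω) ∧
      ∫ ω, g ω ∂μ ≤ 16 * (2 * (50 + τ) ^ 2 + 4) * n ∧
      ∀ ω y x, |⟪u y, randomMap Z ω x⟫| ≤ √(g ω) * ‖y‖ * ‖x‖ := by
  obtain ⟨N, hNc, hN1, hN⟩ := exists_net (EuclideanSpace ℝ (Fin r))
  obtain ⟨N', hNc', hN1', hN'⟩ := exists_net (EuclideanSpace ℝ (Fin n))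
  rw [finrank_euclideanSpace_fin] at hNc hNc'
  have hn0 : (0 : ℝ) < n := by exact_mod_cast hn
  have hn1 : (1 : ℝ) ≤ n := by exact_mod_cast hn
  have hsq : ∀ {k : ℕ} (v : EuclideanSpace ℝ (Fin k)), ‖v‖ ≤ 1 → ∑ i, v i ^ 2 ≤ 1 := by
    intro k v hv
    rw [← EuclideanSpace.real_norm_sq_eq]
    exact pow_le_one₀ (norm_nonneg _) hv
  have hform : ∀ y x ω, ⟪u y, randomMap Z ω x⟫ = ∑ i, u y i * ∑ j, Z i j ω * x j := by
    intro y x ω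
    simp [PiLp.inner_apply, randomMap_apply, mul_comm]
  have hb : ∀ p ∈ N ×ˢ N', ∀ t : ℝ,
      Integrable (fun ω => Real.exp (t * ⟪u p.1, randomMap Z ω p.2⟫)) μ ∧
      ∫ ω, Real.exp (t * ⟪u p.1, randomMap Z ω p.2⟫) ∂μ ≤ Real.exp (τ * t ^ 2) := by
    intro p hp t
    rw [Finset.mem_product] at hp
    simp_rw [hform]
    exact hν.bilinear hτ hZ hind _ _ (hsq _ (by rw [u.norm_map]; exact hN1 _ hp.1))
      (hsq _ (hN1' _ hp.2)) t
  -- The balance `t = √n` makes both `log |N × N'|` and `τ t ^ 2` of order `n`.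
  obtain ⟨g, hg, hg0, hgd, hgi⟩ := exists_dominating_sq (μ := μ) (N ×ˢ N')
    (fun p ω => ⟪u p.1, randomMap Z ω p.2⟫) (t := √n) (b := τ * n) (L := n * (50 + τ))
    (Real.sqrt_pos.2 hn0) (fun p hp t _ => (hb p hp t).1)
    (fun p hp t ht => by
      refine (hb p hp t).2.trans_eq ?_
      rw [← sq_abs, ht, Real.sq_sqrt hn0.le])
    (by
      have h1 : (((N ×ˢ N').card : ℕ) : ℝ) ≤ 25 ^ n := by
        rw [Finset.card_product]
        have : N.card * N'.card ≤ 5 ^ n * 5 ^ n :=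
          Nat.mul_le_mul (hNc.trans (Nat.pow_le_pow_right (by norm_num) hr)) hNc'
        rw [← mul_pow] at this
        exact_mod_cast this
      have h2 : (2 : ℝ) ≤ 2 ^ n := le_self_pow₀ (by norm_num) (by omega)
      calc _ ≤ 2 ^ n * 25 ^ n * Real.exp (τ * n) := by gcongr
        _ = 50 ^ n * Real.exp (τ * n) := by rw [← mul_pow]; norm_num
        _ ≤ Real.exp 50 ^ n * Real.exp (τ * n) := by
            gcongr; linarith [Real.add_one_le_exp (50 : ℝ)]
        _ = _ := by rw [← Real.exp_nat_mul, ← Real.exp_add]; ring_nf)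
  refine ⟨fun ω => 16 * g ω, hg.const_mul _, fun ω => by linarith [hg0 ω], ?_, ?_⟩
  · rw [integral_const_mul]
    rw [Real.sq_sqrt hn0.le, le_div_iff₀ hn0] at hgi
    have : (∫ ω, g ω ∂μ) * n ≤ (2 * (50 + τ) ^ 2 + 4) * n * n := by nlinarith
    linarith [le_of_mul_le_mul_right this hn0]
  · intro ω y x
    let f : EuclideanSpace ℝ (Fin r) →ₗ[ℝ] EuclideanSpace ℝ (Fin n) →ₗ[ℝ] ℝ :=
      (innerₗ (EuclideanSpace ℝ (Fin m))).compl₁₂ u.toLinearMap (randomMap Z ω)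
    have := abs_le_of_nets hN hN' f (M := √(g ω)) (fun y hy x hx =>
      Real.abs_le_sqrt (hgd (y, x) (Finset.mk_mem_product hy hx) ω)) y x
    rw [Real.sqrt_mul (by norm_num), show √(16 : ℝ) = 4 by
      rw [show (16 : ℝ) = 4 ^ 2 by norm_num, Real.sqrt_sq (by norm_num)]]
    exact this

/-- The sample covariance of the noise deviates from its expectation `m • 1` by
`O(√(mn) + n)` in operator norm, in mean square. -/
theorem exists_dominating_covariance (hτ : 0 < τ) (hν : IsStdSubGaussian τ ν)
    (hZ : ∀ i j, HasLaw (Z i j) ν μ)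
    (hind : iIndepFun (fun ij : Fin m × Fin n => Z ij.1 ij.2) μ) (hn : 1 ≤ n)
    {c : ℝ} (hc : c = 1 / (16 * τ)) :
    ∃ g : Ω → ℝ, Integrable g μ ∧ (∀ ω, 0 ≤ g ω) ∧
      ∫ ω, g ω ∂μ ≤ 64 * (2 * (50 + 4 * Real.exp (2 * c)) ^ 2 + 4) / c ^ 2 * (n ^ 2 + n * m) ∧
      ∀ ω x y, |⟪randomMap Z ω x, randomMap Z ω y⟫ - m * ⟪x, y⟫| ≤ √(g ω) * ‖x‖ * ‖y‖ := by
  classical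
  obtain ⟨N, hNc, hN1, hN⟩ := exists_net (EuclideanSpace ℝ (Fin n))
  rw [finrank_euclideanSpace_fin] at hNc
  have hn0 : (0 : ℝ) < n := by exact_mod_cast hn
  have hn1 : (1 : ℝ) ≤ n := by exact_mod_cast hn
  have hm0 : (0 : ℝ) ≤ m := Nat.cast_nonneg m
  have hc0 : 0 < c := by rw [hc]; positivity
  -- By polarization, the bilinear form on the net is read off from the quadratic form on `S`.
  let S : Finset (EuclideanSpace ℝ (Fin n)) :=
    (N ×ˢ N).image (fun p => (1 / 2 : ℝ) • (p.1 + p.2)) ∪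
      (N ×ˢ N).image fun p => (1 / 2 : ℝ) • (p.1 - p.2)
  have hS1 : ∀ z ∈ S, ‖z‖ ≤ 1 := by
    intro z hz
    rcases Finset.mem_union.1 hz with h | h <;> obtain ⟨p, hp, rfl⟩ := Finset.mem_image.1 h <;>
      rw [Finset.mem_product] at hp <;> rw [norm_smul, Real.norm_of_nonneg (by norm_num)]
    · linarith [norm_add_le p.1 p.2, hN1 _ hp.1, hN1 _ hp.2]
    · linarith [norm_sub_le p.1 p.2, hN1 _ hp.1, hN1 _ hp.2]
  have hSc : (S.card : ℝ) ≤ 2 * 25 ^ n := by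
    have h1 : S.card ≤ 5 ^ n * 5 ^ n + 5 ^ n * 5 ^ n := by
      refine (Finset.card_union_le _ _).trans (add_le_add ?_ ?_) <;>
      · refine Finset.card_image_le.trans ?_
        rw [Finset.card_product]
        exact Nat.mul_le_mul hNc hNc
    rw [← mul_pow] at h1
    have h2 : (S.card : ℝ) ≤ 25 ^ n + 25 ^ n := by exact_mod_cast h1
    linarith
  set q : EuclideanSpace ℝ (Fin n) → Ω → ℝ := fun z ω => ‖randomMap Z ω z‖ ^ 2 - m * ‖z‖ ^ 2
    with hq
  have hform : ∀ z ω, q z ω = ∑ i, (∑ j, Z i j ω * z j) ^ 2 - m * ∑ j, z j ^ 2 := by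
    intro z ω
    simp only [hq, EuclideanSpace.real_norm_sq_eq, randomMap_apply]
  have hb : ∀ z ∈ S, ∀ t : ℝ, |t| ≤ c → Integrable (fun ω => Real.exp (t * q z ω)) μ ∧
      ∫ ω, Real.exp (t * q z ω) ∂μ ≤ Real.exp (4 * Real.exp (2 * c) / c ^ 2 * m * t ^ 2) := by
    intro z hz t ht
    simp_rw [hform]
    refine hν.quadratic hτ hZ hind _ ?_ hc ht
    rw [← EuclideanSpace.real_norm_sq_eq]
    exact pow_le_one₀ (norm_nonneg _) (hS1 z hz)
  -- The best admissible exponent: `t ^ 2 = c ^ 2 n / (n + m)` keeps both `t ≤ c` and `m t ^ 2 = O(n)`.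
  set t := c * √(n / (n + m)) with ht
  have ht2 : t ^ 2 = c ^ 2 * (n / (n + m)) := by
    rw [ht, mul_pow, Real.sq_sqrt (by positivity)]
  have ht0 : 0 < t := by positivity
  have htc : t ≤ c := by
    refine mul_le_of_le_one_right hc0.le (Real.sqrt_le_one.2 ?_)
    rw [div_le_one (by positivity)]; linarith
  set K := 4 * Real.exp (2 * c) with hK
  have hK0 : 0 < K := by positivity
  obtain ⟨g, hg, hg0, hgd, hgi⟩ := exists_dominating_sq (μ := μ) S q (t := t) (b := K * n)
    (L := n * (50 + K)) ht0 (fun z hz u hu => (hb z hz u (hu.trans_le htc)).1)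
    (fun z hz u hu => by
      refine (hb z hz u (hu.trans_le htc)).2.trans (Real.exp_le_exp.2 ?_)
      rw [← sq_abs u, hu, ht2]
      have : K / c ^ 2 * m * (c ^ 2 * (n / (n + m))) = K * n * (m / (n + m)) := by
        field_simp
      rw [this]
      refine mul_le_of_le_one_right (by positivity) ?_
      rw [div_le_one (by positivity)]; linarith)
    (by
      have h2 : (2 : ℝ) ≤ 2 ^ n := le_self_pow₀ (by norm_num) (by omega)
      have h4 : (100 : ℝ) ^ n ≤ Real.exp 50 ^ n := by
        have : (100 : ℝ) ≤ Real.exp 50 := by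
          have := Real.add_one_le_exp (25 : ℝ)
          have h5 : Real.exp 50 = Real.exp 25 * Real.exp 25 := by rw [← Real.exp_add]; norm_num
          nlinarith
        gcongr
      calc 2 * (S.card : ℝ) * Real.exp (K * n) ≤ 2 ^ n * (2 ^ n * 25 ^ n) * Real.exp (K * n) := by
            gcongr
            exact hSc.trans (by gcongr)
        _ = 100 ^ n * Real.exp (K * n) := by rw [← mul_pow, ← mul_pow]; norm_num
        _ ≤ Real.exp 50 ^ n * Real.exp (K * n) := by gcongr
        _ = _ := by rw [← Real.exp_nat_mul, ← Real.exp_add]; ring_nf)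
  refine ⟨fun ω => 64 * g ω, hg.const_mul _, fun ω => by linarith [hg0 ω], ?_, ?_⟩
  · rw [integral_const_mul]
    have h1 : (2 * (n * (50 + K)) ^ 2 + 4) / t ^ 2 ≤ (2 * (50 + K) ^ 2 + 4) * n ^ 2 / t ^ 2 := by
      gcongr
      nlinarith
    have h2 : (2 * (50 + K) ^ 2 + 4) * n ^ 2 / t ^ 2 =
        (2 * (50 + K) ^ 2 + 4) / c ^ 2 * (n ^ 2 + n * m) := by
      rw [ht2]; field_simp
    calc 64 * ∫ ω, g ω ∂μ ≤ 64 * ((2 * (50 + K) ^ 2 + 4) / c ^ 2 * (n ^ 2 + n * m)) := by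
          linarith
      _ = _ := by ring
  · intro ω x y
    let f : EuclideanSpace ℝ (Fin n) →ₗ[ℝ] EuclideanSpace ℝ (Fin n) →ₗ[ℝ] ℝ :=
      (innerₗ (EuclideanSpace ℝ (Fin m))).compl₁₂ (randomMap Z ω) (randomMap Z ω) -
        (m : ℝ) • innerₗ (EuclideanSpace ℝ (Fin n))
    have hf : ∀ x y, f x y = ⟪randomMap Z ω x, randomMap Z ω y⟫ - m * ⟪x, y⟫ := fun x y => by
      simp [f]
    have hpol : ∀ x y, f x y = q ((1 / 2 : ℝ) • (x + y)) ω - q ((1 / 2 : ℝ) • (x - y)) ω := by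
      intro x y
      simp only [hf, hq, map_smul, map_add, map_sub, norm_smul, mul_pow, norm_add_sq_real,
        norm_sub_sq_real, Real.norm_eq_abs, sq_abs]
      ring
    have := abs_le_of_nets hN hN f (M := 2 * √(g ω)) (fun x hx y hy => by
      rw [hpol]
      have h1 := Real.abs_le_sqrt (hgd ((1 / 2 : ℝ) • (x + y)) (Finset.mem_union_left _
        (Finset.mem_image.2 ⟨(x, y), Finset.mk_mem_product hx hy, rfl⟩)) ω)
      have h2 := Real.abs_le_sqrt (hgd ((1 / 2 : ℝ) • (x - y)) (Finset.mem_union_right _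
        (Finset.mem_image.2 ⟨(x, y), Finset.mk_mem_product hx hy, rfl⟩)) ω)
      linarith [abs_sub (q ((1 / 2 : ℝ) • (x + y)) ω) (q ((1 / 2 : ℝ) • (x - y)) ω)]) x y
    rw [hf] at this
    rw [Real.sqrt_mul (by norm_num), show √(64 : ℝ) = 8 by
      rw [show (64 : ℝ) = 8 ^ 2 by norm_num, Real.sqrt_sq (by norm_num)]]
    linarith

end RandomMatrix

/-! ### The perturbation inequality for linear operators -/

section Abstract

variable {E F G : Type*} [NormedAddCommGroup E] [InnerProductSpace ℝ E]
  [NormedAddCommGroup F] [InnerProductSpace ℝ F]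
  [NormedAddCommGroup G] [InnerProductSpace ℝ G] [FiniteDimensional ℝ G]

/-- The perturbation inequality in operator form. Here `P` is the orthogonal projection onto the
kernel of the signal `X`, the isometry `v` parametrizes a subspace on which the perturbed operator
`X + A` acts with singular values at least `ℓ`, and `x'` stands for `((X + A)† (X + A))⁻¹ (v x)`.
Only the compression `α` of the noise to the range of `X` and the deviation `δ` of `A† A` from a
multiple `p` of the identity enter; the size of `X` does not. -/
theorem norm_proj_le (X A : E →ₗ[ℝ] F) (P : E →ₗ[ℝ] E) (v : G →ₗᵢ[ℝ] E) {p ℓ α δ : ℝ}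
    (hXP : ∀ a, X (P a) = 0) (hP : ∀ a b, ⟪P a, b⟫ = ⟪P a, P b⟫)
    (hp : 0 ≤ p) (hℓ : 0 < ℓ) (hα0 : 0 ≤ α) (hδ0 : 0 ≤ δ) (hpδ : p + δ ≤ ℓ ^ 2)
    (hinv : ∀ x : G, ∃ x' : G, ‖x'‖ ≤ ‖x‖ / ℓ ^ 2 ∧ ‖(X + A) (v x')‖ ≤ ‖x‖ / ℓ ∧
      ∀ b, ⟪(X + A) b, (X + A) (v x')⟫ = ⟪b, v x⟫)
    (hα : ∀ a b, |⟪X a, A b⟫| ≤ α * ‖X a‖ * ‖b‖)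
    (hδ : ∀ a b, |⟪A a, A b⟫ - p * ⟪a, b⟫| ≤ δ * ‖a‖ * ‖b‖) (x : G) :
    ‖P (v x)‖ * (ℓ ^ 2 - p) ≤ (2 * α * ℓ + δ) * ‖x‖ := by
  set T : G →L[ℝ] E := LinearMap.toContinuousLinearMap (P ∘ₗ v.toLinearMap) with hT
  have hTx : ∀ x, T x = P (v x) := fun x => rfl
  -- The bound for `T x` again involves `ρ = ‖T‖`, with coefficient `p / ℓ ^ 2`; taking the
  -- supremum over `x` gives an inequality for `ρ` in which this term moves to the left.
  set ρ := ‖T‖ with hρ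
  have key : ∀ x, ‖T x‖ ≤ (2 * α / ℓ + p * ρ / ℓ ^ 2 + δ / ℓ ^ 2) * ‖x‖ := by
    intro x
    obtain ⟨x', hx', hYx', hadj⟩ := hinv x
    have hAx' : ‖A (v x')‖ ≤ ‖x‖ / ℓ := by
      have h1 := (abs_le.1 (hδ (v x') (v x'))).2
      rw [real_inner_self_eq_norm_sq, real_inner_self_eq_norm_sq, v.norm_map] at h1
      have h2 : ‖A (v x')‖ ^ 2 ≤ (ℓ * ‖x'‖) ^ 2 := by
        rw [mul_pow]
        nlinarith [sq_nonneg ‖x'‖]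
      have h3 : ‖A (v x')‖ ≤ ℓ * ‖x'‖ := le_of_sq_le_sq h2 (by positivity)
      calc _ ≤ ℓ * (‖x‖ / ℓ ^ 2) := h3.trans (by gcongr)
        _ = ‖x‖ / ℓ := by field_simp
    have hXx' : ‖X (v x')‖ ≤ 2 * (‖x‖ / ℓ) := by
      have : X (v x') = (X + A) (v x') - A (v x') := by simp
      rw [this]
      linarith [norm_sub_le ((X + A) (v x')) (A (v x'))]
    set q := P (v x) with hq
    have e1 : ‖q‖ ^ 2 = ⟪A q, X (v x')⟫ + (⟪A q, A (v x')⟫ - p * ⟪q, v x'⟫) +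
        p * ⟪q, P (v x')⟫ := by
      rw [← hP, ← real_inner_self_eq_norm_sq]
      have h1 : ⟪q, q⟫ = ⟪q, v x⟫ := (hP _ _).symm
      rw [h1, ← hadj q]
      simp only [LinearMap.add_apply, hq, hXP, zero_add, inner_add_right]
      ring
    have b1 : ⟪A q, X (v x')⟫ ≤ α * (2 * (‖x‖ / ℓ)) * ‖q‖ := by
      rw [real_inner_comm]
      refine (le_abs_self _).trans ((hα _ _).trans ?_)
      gcongr
    have b2 : ⟪A q, A (v x')⟫ - p * ⟪q, v x'⟫ ≤ δ * ‖q‖ * (‖x‖ / ℓ ^ 2) := by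
      refine (le_abs_self _).trans ((hδ _ _).trans ?_)
      rw [v.norm_map]
      gcongr
    have b3 : p * ⟪q, P (v x')⟫ ≤ p * (‖q‖ * (ρ * (‖x‖ / ℓ ^ 2))) := by
      gcongr
      refine (real_inner_le_norm _ _).trans ?_
      gcongr
      exact (T.le_opNorm x').trans (by gcongr)
    have h : ‖q‖ ^ 2 ≤ ((2 * α / ℓ + p * ρ / ℓ ^ 2 + δ / ℓ ^ 2) * ‖x‖) * ‖q‖ := by
      calc ‖q‖ ^ 2 ≤ α * (2 * (‖x‖ / ℓ)) * ‖q‖ + δ * ‖q‖ * (‖x‖ / ℓ ^ 2) +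
            p * (‖q‖ * (ρ * (‖x‖ / ℓ ^ 2))) := by linarith
        _ = _ := by ring
    rw [hTx]
    rcases (norm_nonneg q).eq_or_lt with h0 | h0
    · rw [← h0]; positivity
    · rw [sq] at h
      exact le_of_mul_le_mul_right h h0
  have hle : ρ ≤ 2 * α / ℓ + p * ρ / ℓ ^ 2 + δ / ℓ ^ 2 :=
    T.opNorm_le_bound (by positivity) key
  have hle2 : ρ * (ℓ ^ 2 - p) ≤ 2 * α * ℓ + δ := by
    have h1 := mul_le_mul_of_nonneg_right hle (sq_nonneg ℓ)
    have h2 : (2 * α / ℓ + p * ρ / ℓ ^ 2 + δ / ℓ ^ 2) * ℓ ^ 2 = 2 * α * ℓ + p * ρ + δ := by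
      field_simp
    linarith
  have h3 : 0 ≤ ℓ ^ 2 - p := by linarith
  calc ‖P (v x)‖ * (ℓ ^ 2 - p) ≤ (ρ * ‖x‖) * (ℓ ^ 2 - p) := by
        gcongr
        exact T.le_opNorm x
    _ = (ρ * (ℓ ^ 2 - p)) * ‖x‖ := by ring
    _ ≤ _ := by gcongr

/-- The signal space keeps the perturbed operator large: the compressed noise only costs a
quarter of the signal, and the noise itself adds energy close to `p`. -/
theorem sq_mul_le_norm_add_sq (X A : E →ₗ[ℝ] F) {p σ α δ : ℝ} (hσ : 0 < σ)
    (hασ : α ≤ σ / 8) (hδσ : δ ≤ σ ^ 2 / 8)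
    (hα : ∀ a b, |⟪X a, A b⟫| ≤ α * ‖X a‖ * ‖b‖)
    (hδ : ∀ a b, |⟪A a, A b⟫ - p * ⟪a, b⟫| ≤ δ * ‖a‖ * ‖b‖) {a : E} (ha : σ * ‖a‖ ≤ ‖X a‖) :
    (p + σ ^ 2 / 2) * ‖a‖ ^ 2 ≤ ‖(X + A) a‖ ^ 2 := by
  have h1 := (abs_le.1 (hδ a a)).1
  have h2 := (abs_le.1 (hα a a)).1
  rw [real_inner_self_eq_norm_sq, real_inner_self_eq_norm_sq] at h1
  rw [LinearMap.add_apply, norm_add_sq_real]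
  have h3 : α * ‖X a‖ * ‖a‖ ≤ ‖X a‖ ^ 2 / 8 := by
    calc α * ‖X a‖ * ‖a‖ ≤ σ / 8 * ‖X a‖ * ‖a‖ := by gcongr
      _ = ‖X a‖ * (σ * ‖a‖) / 8 := by ring
      _ ≤ ‖X a‖ * ‖X a‖ / 8 := by gcongr
      _ = _ := by ring
  have h4 : σ ^ 2 * ‖a‖ ^ 2 ≤ ‖X a‖ ^ 2 := by
    rw [← mul_pow]; gcongr
  have h5 : δ * ‖a‖ ^ 2 ≤ σ ^ 2 / 8 * ‖a‖ ^ 2 := by gcongr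
  nlinarith

end Abstract

/-! ### Matrices as maps between Euclidean spaces -/

section MatrixLemmas

variable {m n r : ℕ}

theorem toEuclideanLin_mul_apply {l : ℕ} (A : Matrix (Fin l) (Fin m) ℝ)
    (B : Matrix (Fin m) (Fin n) ℝ) (x : EuclideanSpace ℝ (Fin n)) :
    Matrix.toEuclideanLin (A * B) x = Matrix.toEuclideanLin A (Matrix.toEuclideanLin B x) := by
  rw [Matrix.toEuclideanLin, Matrix.toLpLin_mul 2 2 2]; rfl

theorem inner_toEuclideanLin_left (A : Matrix (Fin m) (Fin n) ℝ)
    (x : EuclideanSpace ℝ (Fin n)) (y : EuclideanSpace ℝ (Fin m)) :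
    ⟪Matrix.toEuclideanLin A x, y⟫ = ⟪x, Matrix.toEuclideanLin Aᵀ y⟫ := by
  rw [← Matrix.conjTranspose_eq_transpose_of_trivial, Matrix.toEuclideanLin_conjTranspose_eq_adjoint,
    LinearMap.adjoint_inner_right]

theorem inner_toEuclideanLin_right (A : Matrix (Fin m) (Fin n) ℝ)
    (x : EuclideanSpace ℝ (Fin n)) (y : EuclideanSpace ℝ (Fin m)) :
    ⟪y, Matrix.toEuclideanLin A x⟫ = ⟪Matrix.toEuclideanLin Aᵀ y, x⟫ := by
  rw [real_inner_comm, inner_toEuclideanLin_left, real_inner_comm]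

/-- The isometry of Euclidean spaces given by a matrix with orthonormal columns. -/
noncomputable def isometryOfOrthonormal (V : Matrix (Fin n) (Fin r) ℝ) (hV : Vᵀ * V = 1) :
    EuclideanSpace ℝ (Fin r) →ₗᵢ[ℝ] EuclideanSpace ℝ (Fin n) :=
  (Matrix.toEuclideanLin V).isometryOfInner fun x y => by
    rw [inner_toEuclideanLin_left, ← toEuclideanLin_mul_apply, hV, Matrix.toEuclideanLin,
      Matrix.toLpLin_one]
    rfl

theorem isometryOfOrthonormal_apply (V : Matrix (Fin n) (Fin r) ℝ) (hV : Vᵀ * V = 1)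
    (x : EuclideanSpace ℝ (Fin r)) :
    isometryOfOrthonormal V hV x = Matrix.toEuclideanLin V x := rfl

theorem norm_toEuclideanLin_of_orthonormal {V : Matrix (Fin n) (Fin r) ℝ} (hV : Vᵀ * V = 1)
    (x : EuclideanSpace ℝ (Fin r)) : ‖Matrix.toEuclideanLin V x‖ = ‖x‖ :=
  (isometryOfOrthonormal V hV).norm_map x

theorem toEuclideanLin_diagonal_apply (d : Fin r → ℝ) (x : EuclideanSpace ℝ (Fin r)) (i : Fin r) :
    Matrix.toEuclideanLin (Matrix.diagonal d) x i = d i * x i := by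
  simp [Matrix.toLpLin_apply, Matrix.mulVec_diagonal]

theorem norm_diagonal_le {d : Fin r → ℝ} {K : ℝ} (hK : 0 ≤ K) (hd : ∀ i, |d i| ≤ K)
    (x : EuclideanSpace ℝ (Fin r)) : ‖Matrix.toEuclideanLin (Matrix.diagonal d) x‖ ≤ K * ‖x‖ := by
  refine le_of_sq_le_sq ?_ (by positivity)
  rw [mul_pow, EuclideanSpace.real_norm_sq_eq, EuclideanSpace.real_norm_sq_eq, Finset.mul_sum]
  refine Finset.sum_le_sum fun i _ => ?_
  rw [toEuclideanLin_diagonal_apply, mul_pow]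
  exact mul_le_mul_of_nonneg_right
    (sq_le_sq.2 ((hd i).trans_eq (abs_of_nonneg hK).symm)) (sq_nonneg _)

theorem le_norm_diagonal {d : Fin r → ℝ} {K : ℝ} (hK : 0 ≤ K) (hd : ∀ i, K ≤ d i)
    (x : EuclideanSpace ℝ (Fin r)) : K * ‖x‖ ≤ ‖Matrix.toEuclideanLin (Matrix.diagonal d) x‖ := by
  refine le_of_sq_le_sq ?_ (norm_nonneg _)
  rw [mul_pow, EuclideanSpace.real_norm_sq_eq, EuclideanSpace.real_norm_sq_eq, Finset.mul_sum]
  refine Finset.sum_le_sum fun i _ => ?_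
  rw [toEuclideanLin_diagonal_apply, mul_pow]
  have := hd i
  gcongr

/-- The rectangular matrix with the sequence `s` on its main diagonal. -/
noncomputable def rectDiagonal (m n : ℕ) (s : ℕ → ℝ) : Matrix (Fin m) (Fin n) ℝ :=
  Matrix.of fun i j => if i.val = j.val then s i.val else 0

theorem rectDiagonal_transpose (s : ℕ → ℝ) : (rectDiagonal m n s)ᵀ = rectDiagonal n m s := by
  ext i j
  simp only [rectDiagonal, Matrix.transpose_apply, Matrix.of_apply, eq_comm (a := j.val)]
  split_ifs with h
  · rw [h]
  · rfl

theorem rectDiagonal_mul_submatrix_one (s : ℕ → ℝ) (hm : r ≤ m) (hn : r ≤ n) :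
    rectDiagonal m n s * (1 : Matrix (Fin n) (Fin n) ℝ).submatrix id (Fin.castLE hn) =
      (1 : Matrix (Fin m) (Fin m) ℝ).submatrix id (Fin.castLE hm) *
        Matrix.diagonal fun i : Fin r => s i := by
  ext i j
  rw [Matrix.mul_diagonal, Matrix.mul_apply, Finset.sum_eq_single (Fin.castLE hn j)]
  · by_cases hij : i.val = j.val
    · have : i = Fin.castLE hm j := Fin.ext hij
      simp [rectDiagonal, this, Matrix.one_apply]
    · have : i ≠ Fin.castLE hm j := fun h => hij (congrArg Fin.val h)
      simp [rectDiagonal, hij, this]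
  · intro k _ hk
    simp [hk]
  · simp

/-- A vector whose first `k` coordinates vanish is stretched at most by the entry `s k`. -/
theorem norm_rectDiagonal_le {s : ℕ → ℝ} (hs : Antitone s) (hs0 : ∀ k, 0 ≤ s k) {k : ℕ}
    {c : EuclideanSpace ℝ (Fin n)} (hc : ∀ j : Fin n, j.val < k → c j = 0) :
    ‖Matrix.toEuclideanLin (rectDiagonal m n s) c‖ ≤ s k * ‖c‖ := by
  refine le_of_sq_le_sq ?_ (mul_nonneg (hs0 k) (norm_nonneg _))
  rw [mul_pow, EuclideanSpace.real_norm_sq_eq, EuclideanSpace.real_norm_sq_eq, Finset.mul_sum]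
  have hrow : ∀ i : Fin m, (Matrix.toEuclideanLin (rectDiagonal m n s) c i) ^ 2 =
      ∑ j : Fin n, if i.val = j.val then s i ^ 2 * c j ^ 2 else 0 := by
    intro i
    have h1 : Matrix.toEuclideanLin (rectDiagonal m n s) c i =
        ∑ j : Fin n, if i.val = j.val then s i * c j else 0 := by
      simp [Matrix.toLpLin_apply, Matrix.mulVec, dotProduct, rectDiagonal]
    rw [h1]
    by_cases hi : i.val < n
    · rw [Finset.sum_eq_single ⟨i.val, hi⟩, Finset.sum_eq_single ⟨i.val, hi⟩]
      · simp [mul_pow]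
      · intro j _ hj; rw [if_neg fun h => hj (Fin.ext h.symm)]
      · simp
      · intro j _ hj; rw [if_neg fun h => hj (Fin.ext h.symm)]
      · simp
    · have : ∀ j : Fin n, i.val ≠ j.val := fun j h => hi (h ▸ j.isLt)
      simp [this]
  simp_rw [hrow]
  rw [Finset.sum_comm]
  refine Finset.sum_le_sum fun j _ => ?_
  rcases lt_or_ge j.val k with hj | hj
  · simp [hc j hj]
  · have hb : ∀ i : Fin m, (if i.val = j.val then s i ^ 2 * c j ^ 2 else 0) ≤
        if i.val = j.val then s k ^ 2 * c j ^ 2 else 0 := by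
      intro i
      split_ifs with h
      · have h1 : s i ≤ s k := hs (h ▸ hj)
        have h2 := hs0 i
        gcongr
      · exact le_rfl
    refine (Finset.sum_le_sum fun i _ => hb i).trans ?_
    by_cases hjm : j.val < m
    · rw [Finset.sum_eq_single ⟨j.val, hjm⟩]
      · simp
      · intro i _ hi; rw [if_neg fun h => hi (Fin.ext h)]
      · simp
    · have : ∀ i : Fin m, i.val ≠ j.val := fun i h => hjm (h ▸ i.isLt)
      simp only [this, if_false, Finset.sum_const_zero]
      positivity

end MatrixLemmas

/-! ### The perturbation inequality for leading singular vectors -/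

section Deterministic

variable {m n r : ℕ}

theorem transpose_submatrix_mul_self {n : ℕ} {Q : Matrix (Fin n) (Fin n) ℝ}
    (hQ : Q ∈ Matrix.orthogonalGroup (Fin n) ℝ) (hn : r ≤ n) :
    (Q.submatrix id (Fin.castLE hn))ᵀ * Q.submatrix id (Fin.castLE hn) = 1 := by
  have h : Qᵀ * Q = 1 := (Matrix.mem_orthogonalGroup_iff' (Fin n) ℝ).1 hQ
  rw [Matrix.transpose_submatrix, ← Matrix.submatrix_mul _ _ _ _ _ Function.bijective_id, h]
  exact Matrix.submatrix_one _ (Fin.castLE_injective hn)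

theorem submatrix_eq_mul_one_submatrix (Q : Matrix (Fin n) (Fin n) ℝ) (hn : r ≤ n) :
    Q.submatrix id (Fin.castLE hn) =
      Q * (1 : Matrix (Fin n) (Fin n) ℝ).submatrix id (Fin.castLE hn) := by
  ext i j
  simp [Matrix.mul_apply, Matrix.one_apply]

theorem svd_mul_leading {U₀ : Matrix (Fin m) (Fin m) ℝ} {V₀ : Matrix (Fin n) (Fin n) ℝ}
    (hV₀ : V₀ ∈ Matrix.orthogonalGroup (Fin n) ℝ) (s : ℕ → ℝ) (hm : r ≤ m) (hn : r ≤ n) :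
    U₀ * rectDiagonal m n s * V₀ᵀ * V₀.submatrix id (Fin.castLE hn) =
      U₀.submatrix id (Fin.castLE hm) * Matrix.diagonal fun i : Fin r => s i := by
  have h : V₀ᵀ * V₀ = 1 := (Matrix.mem_orthogonalGroup_iff' (Fin n) ℝ).1 hV₀
  rw [submatrix_eq_mul_one_submatrix V₀, submatrix_eq_mul_one_submatrix U₀, Matrix.mul_assoc,
    ← Matrix.mul_assoc V₀ᵀ, h, Matrix.one_mul, Matrix.mul_assoc,
    rectDiagonal_mul_submatrix_one s hm hn, Matrix.mul_assoc]

theorem transpose_svd (U₀ : Matrix (Fin m) (Fin m) ℝ) (V₀ : Matrix (Fin n) (Fin n) ℝ) (s : ℕ → ℝ) :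
    (U₀ * rectDiagonal m n s * V₀ᵀ)ᵀ = V₀ * rectDiagonal n m s * U₀ᵀ := by
  rw [Matrix.transpose_mul, Matrix.transpose_mul, Matrix.transpose_transpose,
    rectDiagonal_transpose, Matrix.mul_assoc]

/-- Lower bound for the `r`-th singular value `s (r - 1)` of the perturbed matrix: some vector of
the `r`-dimensional signal space is orthogonal to the first `r - 1` right singular vectors. -/
theorem le_sq_of_svd (hr : 1 ≤ r) {Y : Matrix (Fin m) (Fin n) ℝ}
    {V : Matrix (Fin n) (Fin r) ℝ} (hV : Vᵀ * V = 1) {lam : ℝ}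
    (hY : ∀ y, lam * ‖Matrix.toEuclideanLin V y‖ ^ 2 ≤
      ‖Matrix.toEuclideanLin Y (Matrix.toEuclideanLin V y)‖ ^ 2)
    {U₀ : Matrix (Fin m) (Fin m) ℝ} (hU₀ : U₀ ∈ Matrix.orthogonalGroup (Fin m) ℝ)
    {V₀ : Matrix (Fin n) (Fin n) ℝ} (hV₀ : V₀ ∈ Matrix.orthogonalGroup (Fin n) ℝ)
    {s : ℕ → ℝ} (hs : Antitone s) (hs0 : ∀ k, 0 ≤ s k)
    (hn : r ≤ n) (hYs : Y = U₀ * rectDiagonal m n s * V₀ᵀ) : lam ≤ s (r - 1) ^ 2 := by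
  have hU : U₀ᵀ * U₀ = 1 := (Matrix.mem_orthogonalGroup_iff' (Fin m) ℝ).1 hU₀
  have hVT : V₀ᵀᵀ * V₀ᵀ = 1 := by
    rw [Matrix.transpose_transpose]
    exact (Matrix.mem_orthogonalGroup_iff (Fin n) ℝ).1 hV₀
  -- The kernel of `f` parametrizes the signal vectors orthogonal to the first `r - 1` columns
  -- of `V₀`; it is nonzero by dimension count.
  let f : EuclideanSpace ℝ (Fin r) →ₗ[ℝ] (Fin (r - 1) → ℝ) :=
    { toFun := fun y k => Matrix.toEuclideanLin V₀ᵀ (Matrix.toEuclideanLin V y)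
        (Fin.castLE (by omega) k)
      map_add' := fun y z => by ext k; simp only [map_add, PiLp.add_apply, Pi.add_apply]
      map_smul' := fun a y => by ext k; simp }
  have hker : f.ker ≠ ⊥ := LinearMap.ker_ne_bot_of_finrank_lt (by
    rw [Module.finrank_fin_fun, finrank_euclideanSpace_fin]; omega)
  obtain ⟨y, hy, hy0⟩ := Submodule.exists_mem_ne_zero_of_ne_bot hker
  have hc := norm_rectDiagonal_le (m := m) hs hs0 (k := r - 1)
    (c := Matrix.toEuclideanLin V₀ᵀ (Matrix.toEuclideanLin V y)) (fun j hj => by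
      have := congrFun (LinearMap.mem_ker.1 hy) ⟨j.val, hj⟩
      exact this)
  have h1 := hY y
  rw [hYs, toEuclideanLin_mul_apply, toEuclideanLin_mul_apply,
    norm_toEuclideanLin_of_orthonormal hU] at h1
  rw [norm_toEuclideanLin_of_orthonormal hVT] at hc
  rw [norm_toEuclideanLin_of_orthonormal hV] at hc h1
  have hpos : 0 < ‖y‖ ^ 2 := by
    have := norm_pos_iff.2 hy0
    positivity
  refine le_of_mul_le_mul_right ?_ hpos
  rw [← mul_pow]
  exact h1.trans (by gcongr)

/-- The perturbation bound for the leading right singular vectors `V̂` of `X + A`, where `X` has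
singular values at least `σ`: the part of `V̂ x` orthogonal to the columns of `V` is small. -/
theorem norm_sub_proj_le (hr : 1 ≤ r) {X A : Matrix (Fin m) (Fin n) ℝ}
    {U : Matrix (Fin m) (Fin r) ℝ} {V : Matrix (Fin n) (Fin r) ℝ} (hU : Uᵀ * U = 1)
    (hV : Vᵀ * V = 1) {d : Fin r → ℝ} (hX : X = U * Matrix.diagonal d * Vᵀ)
    {σ : ℝ} (hσ : 0 < σ) (hd : ∀ k, σ ≤ d k)
    {U₀ : Matrix (Fin m) (Fin m) ℝ} (hU₀ : U₀ ∈ Matrix.orthogonalGroup (Fin m) ℝ)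
    {V₀ : Matrix (Fin n) (Fin n) ℝ} (hV₀ : V₀ ∈ Matrix.orthogonalGroup (Fin n) ℝ)
    {s : ℕ → ℝ} (hs : Antitone s) (hs0 : ∀ k, 0 ≤ s k) (hm : r ≤ m) (hn : r ≤ n)
    (hY : X + A = U₀ * rectDiagonal m n s * V₀ᵀ) {α δ : ℝ} (hα0 : 0 ≤ α) (hδ0 : 0 ≤ δ)
    (hασ : α ≤ σ / 8) (hδσ : δ ≤ σ ^ 2 / 8)
    (hα : ∀ y x, |⟪Matrix.toEuclideanLin U y, Matrix.toEuclideanLin A x⟫| ≤ α * ‖y‖ * ‖x‖)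
    (hδ : ∀ x y, |⟪Matrix.toEuclideanLin A x, Matrix.toEuclideanLin A y⟫ - m * ⟪x, y⟫| ≤
      δ * ‖x‖ * ‖y‖) (x : EuclideanSpace ℝ (Fin r)) :
    ‖Matrix.toEuclideanLin (V₀.submatrix id (Fin.castLE hn) -
        V * (Vᵀ * V₀.submatrix id (Fin.castLE hn))) x‖ * (σ ^ 2 / 2) ≤
      (2 * α * √(m + σ ^ 2 / 2) + δ) * ‖x‖ := by
  set Vh := V₀.submatrix id (Fin.castLE hn) with hVh
  set Uh := U₀.submatrix id (Fin.castLE hm) with hUh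
  have hVho : Vhᵀ * Vh = 1 := transpose_submatrix_mul_self hV₀ hn
  have hUho : Uhᵀ * Uh = 1 := transpose_submatrix_mul_self hU₀ hm
  set D : Matrix (Fin r) (Fin r) ℝ := Matrix.diagonal fun i : Fin r => s i with hD
  have hYV : (X + A) * Vh = Uh * D := by rw [hY]; exact svd_mul_leading hV₀ s hm hn
  have hYU : (X + A)ᵀ * Uh = Vh * D := by
    rw [hY, transpose_svd]; exact svd_mul_leading hU₀ s hn hm
  have hadd : ∀ a, (Matrix.toEuclideanLin X + Matrix.toEuclideanLin A) a =
      Matrix.toEuclideanLin (X + A) a := fun a => by rw [map_add]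
  have hXU : ∀ a, Matrix.toEuclideanLin X a = Matrix.toEuclideanLin U
      (Matrix.toEuclideanLin (Matrix.diagonal d) (Matrix.toEuclideanLin Vᵀ a)) := fun a => by
    rw [hX, toEuclideanLin_mul_apply, toEuclideanLin_mul_apply]
  have hα' : ∀ a b, |⟪Matrix.toEuclideanLin X a, Matrix.toEuclideanLin A b⟫| ≤
      α * ‖Matrix.toEuclideanLin X a‖ * ‖b‖ := by
    intro a b
    rw [hXU, norm_toEuclideanLin_of_orthonormal hU]
    exact hα _ _
  set lam : ℝ := m + σ ^ 2 / 2 with hlam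
  have hlam0 : 0 < lam := by positivity
  have hgap : lam ≤ s (r - 1) ^ 2 := by
    refine le_sq_of_svd hr hV (fun y => ?_) hU₀ hV₀ hs hs0 hn hY
    rw [← hadd]
    refine sq_mul_le_norm_add_sq _ _ hσ hασ hδσ hα' hδ ?_
    rw [hXU, norm_toEuclideanLin_of_orthonormal hU, norm_toEuclideanLin_of_orthonormal hV,
      ← toEuclideanLin_mul_apply Vᵀ, hV, Matrix.toEuclideanLin, Matrix.toLpLin_one]
    exact le_norm_diagonal hσ.le hd y
  have hsi : ∀ i : Fin r, √lam ≤ s i := fun i =>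
    (Real.sqrt_le_left (hs0 _)).2 hgap |>.trans (hs (by omega))
  have hl0 : 0 < √lam := Real.sqrt_pos.2 hlam0
  have hsi0 : ∀ i : Fin r, 0 < s i := fun i => hl0.trans_le (hsi i)
  have hPx : ∀ x, Matrix.toEuclideanLin (Vh - V * (Vᵀ * Vh)) x =
      Matrix.toEuclideanLin (1 - V * Vᵀ) (isometryOfOrthonormal Vh hVho x) := fun x => by
    rw [isometryOfOrthonormal_apply, ← toEuclideanLin_mul_apply, Matrix.sub_mul, Matrix.one_mul,
      Matrix.mul_assoc]
  have hPs : (1 - V * Vᵀ)ᵀ = 1 - V * Vᵀ := by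
    rw [Matrix.transpose_sub, Matrix.transpose_one, Matrix.transpose_mul, Matrix.transpose_transpose]
  have hPV : Vᵀ * (1 - V * Vᵀ) = 0 := by
    rw [Matrix.mul_sub, Matrix.mul_one, ← Matrix.mul_assoc, hV, Matrix.one_mul, sub_self]
  have hPP : (1 - V * Vᵀ) * (1 - V * Vᵀ) = 1 - V * Vᵀ := by
    rw [Matrix.sub_mul, Matrix.one_mul, Matrix.mul_assoc, hPV, Matrix.mul_zero, sub_zero]
  have hsq : √lam ^ 2 = lam := Real.sq_sqrt hlam0.le
  have hmain := norm_proj_le (Matrix.toEuclideanLin X) (Matrix.toEuclideanLin A)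
    (Matrix.toEuclideanLin (1 - V * Vᵀ)) (isometryOfOrthonormal Vh hVho) (p := m) (ℓ := √lam)
    (α := α) (δ := δ)
    (fun a => by
      rw [hXU, ← toEuclideanLin_mul_apply Vᵀ, hPV]; simp)
    (fun a b => by
      rw [inner_toEuclideanLin_left, inner_toEuclideanLin_left, ← toEuclideanLin_mul_apply, hPs,
        hPP])
    (Nat.cast_nonneg m) hl0 hα0 hδ0
    (by rw [hsq, hlam]; nlinarith [sq_nonneg σ])
    (fun x => by
      set x₁ := Matrix.toEuclideanLin (Matrix.diagonal fun i : Fin r => (s i)⁻¹) x with hx₁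
      set x₂ := Matrix.toEuclideanLin (Matrix.diagonal fun i : Fin r => (s i)⁻¹) x₁ with hx₂
      have hn1 : ∀ z : EuclideanSpace ℝ (Fin r), ‖Matrix.toEuclideanLin
          (Matrix.diagonal fun i : Fin r => (s i)⁻¹) z‖ ≤ ‖z‖ / √lam := fun z => by
        rw [div_eq_inv_mul]
        refine norm_diagonal_le (by positivity) (fun i => ?_) z
        rw [abs_of_pos (inv_pos.2 (hsi0 i))]
        exact inv_anti₀ hl0 (hsi i)
      have hinv : ∀ z : EuclideanSpace ℝ (Fin r), Matrix.toEuclideanLin D (Matrix.toEuclideanLin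
          (Matrix.diagonal fun i : Fin r => (s i)⁻¹) z) = z := fun z => by
        ext i
        rw [toEuclideanLin_diagonal_apply, toEuclideanLin_diagonal_apply,
          mul_inv_cancel_left₀ (hsi0 i).ne']
      have hYx : (Matrix.toEuclideanLin X + Matrix.toEuclideanLin A)
          (isometryOfOrthonormal Vh hVho x₂) = Matrix.toEuclideanLin Uh x₁ := by
        rw [hadd, isometryOfOrthonormal_apply, ← toEuclideanLin_mul_apply, hYV,
          toEuclideanLin_mul_apply, hinv]
      refine ⟨x₂, ?_, ?_, fun b => ?_⟩
      · calc ‖x₂‖ ≤ ‖x₁‖ / √lam := hn1 _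
          _ ≤ (‖x‖ / √lam) / √lam := by gcongr; exact hn1 _
          _ = _ := by rw [div_div, sq]
      · rw [hYx, norm_toEuclideanLin_of_orthonormal hUho]
        exact hn1 _
      · rw [hYx, hadd, inner_toEuclideanLin_left, ← toEuclideanLin_mul_apply, hYU,
          toEuclideanLin_mul_apply, hinv]
        rfl)
    hα' hδ x
  rw [← hPx, hsq] at hmain
  rwa [show lam - m = σ ^ 2 / 2 by rw [hlam]; ring] at hmain

end Deterministic

/-! ### Principal angles -/

section PrincipalAngles

/-- The right singular vectors: an orthonormal basis diagonalizing `x ↦ ‖T x‖ ^ 2`. -/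
theorem exists_basis_norm_sq_eq {E F : Type*} [NormedAddCommGroup E] [InnerProductSpace ℝ E]
    [FiniteDimensional ℝ E] [NormedAddCommGroup F] [InnerProductSpace ℝ F] [FiniteDimensional ℝ F]
    (T : E →ₗ[ℝ] F) {r : ℕ} (hr : Module.finrank ℝ E = r) :
    ∃ b : OrthonormalBasis (Fin r) ℝ E,
      ∀ x, ‖T x‖ ^ 2 = ∑ k : Fin r, T.singularValues k ^ 2 * ⟪b k, x⟫ ^ 2 := by
  have hS := T.isSymmetric_adjoint_comp_self
  refine ⟨hS.eigenvectorBasis hr, fun x => ?_⟩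
  rw [← real_inner_self_eq_norm_sq, ← LinearMap.adjoint_inner_left,
    ← OrthonormalBasis.sum_inner_mul_inner (hS.eigenvectorBasis hr)]
  refine Finset.sum_congr rfl fun k _ => ?_
  have h1 : ⟪T.adjoint (T x), hS.eigenvectorBasis hr k⟫ =
      ⟪x, (T.adjoint ∘ₗ T) (hS.eigenvectorBasis hr k)⟫ := hS x _
  rw [h1, hS.apply_eigenvectorBasis, T.sq_singularValues_fin hr, inner_smul_right,
    real_inner_comm x]
  simp only [RCLike.ofReal_real_eq_id, id]
  ring

variable {p r : ℕ}

open scoped Matrix.Norms.L2Operator in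
theorem specNorm_nonneg (D : Matrix (Fin p) (Fin r) ℝ) : 0 ≤ specNorm D :=
  norm_nonneg D

open scoped Matrix.Norms.L2Operator in
theorem specNorm_le {D : Matrix (Fin p) (Fin r) ℝ} {M : ℝ} (hM : 0 ≤ M)
    (h : ∀ x, ‖Matrix.toEuclideanLin D x‖ ≤ M * ‖x‖) : specNorm D ≤ M := by
  rw [specNorm, Matrix.l2_opNorm_def]
  exact ContinuousLinearMap.opNorm_le_bound _ hM h

open scoped Matrix.Norms.L2Operator in
theorem norm_le_specNorm (D : Matrix (Fin p) (Fin r) ℝ) (x : EuclideanSpace ℝ (Fin r)) :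
    ‖Matrix.toEuclideanLin D x‖ ≤ specNorm D * ‖x‖ := by
  rw [specNorm, Matrix.l2_opNorm_def]
  exact ContinuousLinearMap.le_opNorm
    ((Matrix.toEuclideanLin ≪≫ₗ LinearMap.toContinuousLinearMap) D) x

open scoped Matrix.Norms.L2Operator in
theorem specNorm_diagonal (v : Fin r → ℝ) : specNorm (Matrix.diagonal v) = ‖v‖ :=
  Matrix.l2_opNorm_diagonal v

open scoped Matrix.Norms.L2Operator in
theorem continuous_specNorm : Continuous (specNorm : Matrix (Fin p) (Fin r) ℝ → ℝ) :=
  continuous_norm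

open scoped Matrix.Norms.Frobenius in
theorem frobNorm_sq (D : Matrix (Fin p) (Fin r) ℝ) : frobNorm D ^ 2 = ∑ i, ∑ j, D i j ^ 2 := by
  rw [frobNorm, Matrix.frobenius_norm_def, ← Real.sqrt_eq_rpow, Real.sq_sqrt]
  · simp
  · exact Finset.sum_nonneg fun i _ => Finset.sum_nonneg fun j _ => by positivity

theorem frobNorm_diagonal_sq (v : Fin r → ℝ) :
    frobNorm (Matrix.diagonal v) ^ 2 = ∑ k, v k ^ 2 := by
  rw [frobNorm_sq]
  refine Finset.sum_congr rfl fun i _ => ?_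
  rw [Finset.sum_eq_single i]
  · simp
  · intro j _ hj; simp [Matrix.diagonal_apply_ne' _ hj]
  · simp

/-- The Frobenius norm can be computed in any orthonormal basis of the domain. -/
theorem frobNorm_sq_eq_sum_basis (D : Matrix (Fin p) (Fin r) ℝ)
    (b : OrthonormalBasis (Fin r) ℝ (EuclideanSpace ℝ (Fin r))) :
    frobNorm D ^ 2 = ∑ k, ‖Matrix.toEuclideanLin D (b k)‖ ^ 2 := by
  have h : ∀ (k : Fin r) (i : Fin p), Matrix.toEuclideanLin D (b k) i = ⟪b k, WithLp.toLp 2 (D i)⟫ := fun k i => by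
    simp [Matrix.toLpLin_apply, Matrix.mulVec, PiLp.inner_apply, dotProduct]
  simp_rw [frobNorm_sq, EuclideanSpace.real_norm_sq_eq, h]
  conv_rhs => rw [Finset.sum_comm]
  refine Finset.sum_congr rfl fun i _ => ?_
  have := b.sum_sq_norm_inner_right (WithLp.toLp 2 (D i))
  simp only [Real.norm_eq_abs, sq_abs] at this
  rw [this, EuclideanSpace.real_norm_sq_eq]

theorem norm_sub_proj_sq {V W : Matrix (Fin p) (Fin r) ℝ} (hV : Vᵀ * V = 1) (hW : Wᵀ * W = 1)
    (x : EuclideanSpace ℝ (Fin r)) :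
    ‖Matrix.toEuclideanLin (W - V * (Vᵀ * W)) x‖ ^ 2 =
      ‖x‖ ^ 2 - ‖Matrix.toEuclideanLin (Vᵀ * W) x‖ ^ 2 := by
  have h1 := norm_toEuclideanLin_of_orthonormal hW x
  have h2 : ⟪Matrix.toEuclideanLin W x, Matrix.toEuclideanLin (V * (Vᵀ * W)) x⟫ =
      ‖Matrix.toEuclideanLin (Vᵀ * W) x‖ ^ 2 := by
    rw [toEuclideanLin_mul_apply V, inner_toEuclideanLin_right, ← toEuclideanLin_mul_apply,
      real_inner_self_eq_norm_sq]
  have h3 : ‖Matrix.toEuclideanLin (V * (Vᵀ * W)) x‖ = ‖Matrix.toEuclideanLin (Vᵀ * W) x‖ := by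
    rw [toEuclideanLin_mul_apply V, norm_toEuclideanLin_of_orthonormal hV]
  rw [map_sub, LinearMap.sub_apply, norm_sub_sq_real, h1, h2, h3]
  ring

/-- The sines of the principal angles are the singular values of the component of `W` orthogonal
to the columns of `V`. -/
theorem exists_basis_sin {V W : Matrix (Fin p) (Fin r) ℝ} (hV : Vᵀ * V = 1) (hW : Wᵀ * W = 1) :
    ∃ b : OrthonormalBasis (Fin r) ℝ (EuclideanSpace ℝ (Fin r)),
      (∀ k, Real.sin (Real.arccos (sigma (Vᵀ * W) (k.val + 1))) =
        ‖Matrix.toEuclideanLin (W - V * (Vᵀ * W)) (b k)‖) ∧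
      ∀ x, ‖Matrix.toEuclideanLin (W - V * (Vᵀ * W)) x‖ ^ 2 =
        ∑ k : Fin r, Real.sin (Real.arccos (sigma (Vᵀ * W) (k.val + 1))) ^ 2 * ⟪b k, x⟫ ^ 2 := by
  obtain ⟨b, hb⟩ := exists_basis_norm_sq_eq (Matrix.toEuclideanLin (Vᵀ * W))
    (finrank_euclideanSpace_fin (𝕜 := ℝ) (n := r))
  have hσ : ∀ k : Fin r, sigma (Vᵀ * W) (k.val + 1) =
      (Matrix.toEuclideanLin (Vᵀ * W)).singularValues k := fun k => rfl
  have hbk : ∀ k, ‖Matrix.toEuclideanLin (W - V * (Vᵀ * W)) (b k)‖ ^ 2 =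
      1 - sigma (Vᵀ * W) (k.val + 1) ^ 2 := by
    intro k
    rw [norm_sub_proj_sq hV hW, hb, b.orthonormal.1 k, Finset.sum_eq_single k]
    · rw [real_inner_self_eq_norm_sq, b.orthonormal.1 k, hσ]; ring
    · intro j _ hj
      rw [b.orthonormal.2 hj]; ring
    · simp
  have hsin : ∀ k : Fin r, Real.sin (Real.arccos (sigma (Vᵀ * W) (k.val + 1))) =
      ‖Matrix.toEuclideanLin (W - V * (Vᵀ * W)) (b k)‖ := fun k => by
    rw [Real.sin_arccos, ← hbk, Real.sqrt_sq (norm_nonneg _)]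
  refine ⟨b, hsin, fun x => ?_⟩
  have hx := b.sum_sq_norm_inner_right x
  simp only [Real.norm_eq_abs, sq_abs] at hx
  rw [norm_sub_proj_sq hV hW, hb, ← hx, ← Finset.sum_sub_distrib]
  refine Finset.sum_congr rfl fun k _ => ?_
  rw [hsin, hbk, hσ]
  ring

theorem specNorm_sinTheta {V W : Matrix (Fin p) (Fin r) ℝ} (hV : Vᵀ * V = 1) (hW : Wᵀ * W = 1) :
    specNorm (sinTheta V W) = specNorm (W - V * (Vᵀ * W)) := by
  obtain ⟨b, hb, hx⟩ := exists_basis_sin hV hW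
  rw [sinTheta, specNorm_diagonal]
  apply le_antisymm
  · refine (pi_norm_le_iff_of_nonneg (specNorm_nonneg _)).2 fun k => ?_
    rw [hb, norm_norm]
    simpa [b.orthonormal.1 k] using norm_le_specNorm (W - V * (Vᵀ * W)) (b k)
  · refine specNorm_le (norm_nonneg _) fun x => ?_
    refine le_of_sq_le_sq ?_ (by positivity)
    rw [hx, mul_pow, ← b.sum_sq_norm_inner_right x, Finset.mul_sum]
    refine Finset.sum_le_sum fun k _ => ?_
    rw [Real.norm_eq_abs ⟪b k, x⟫, sq_abs]
    refine mul_le_mul_of_nonneg_right ?_ (sq_nonneg _)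
    rw [← sq_abs, ← Real.norm_eq_abs]
    exact pow_le_pow_left₀ (norm_nonneg _) (norm_le_pi_norm
      (fun k : Fin r => Real.sin (Real.arccos (sigma (Vᵀ * W) (k.val + 1)))) k) 2

theorem frobNorm_sinTheta_sq {V W : Matrix (Fin p) (Fin r) ℝ} (hV : Vᵀ * V = 1)
    (hW : Wᵀ * W = 1) :
    frobNorm (sinTheta V W) ^ 2 = frobNorm (W - V * (Vᵀ * W)) ^ 2 := by
  obtain ⟨b, hb, hx⟩ := exists_basis_sin hV hW
  rw [sinTheta, frobNorm_diagonal_sq, frobNorm_sq_eq_sum_basis _ b]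
  exact Finset.sum_congr rfl fun k _ => by rw [hb]

theorem specNorm_sinTheta_sq_le_one (V W : Matrix (Fin p) (Fin r) ℝ) :
    specNorm (sinTheta V W) ^ 2 ≤ 1 := by
  rw [sinTheta, specNorm_diagonal]
  refine pow_le_one₀ (norm_nonneg _) ((pi_norm_le_iff_of_nonneg zero_le_one).2 fun k => ?_)
  rw [Real.norm_eq_abs]
  exact Real.abs_sin_le_one _

theorem frobNorm_sinTheta_sq_le (V W : Matrix (Fin p) (Fin r) ℝ) :
    frobNorm (sinTheta V W) ^ 2 ≤ r * specNorm (sinTheta V W) ^ 2 := by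
  rw [sinTheta, specNorm_diagonal, frobNorm_diagonal_sq]
  set v : Fin r → ℝ := fun k => Real.sin (Real.arccos (sigma (Vᵀ * W) (k.val + 1)))
  calc ∑ k, v k ^ 2 ≤ ∑ _k : Fin r, ‖v‖ ^ 2 := Finset.sum_le_sum fun k _ => by
        rw [← sq_abs, ← Real.norm_eq_abs]
        exact pow_le_pow_left₀ (norm_nonneg _) (norm_le_pi_norm v k) 2
    _ = r * ‖v‖ ^ 2 := by simp

variable {Ω : Type*} [MeasurableSpace Ω] {μ : Measure Ω}

/-- Measurability of the loss: although singular values are not visibly measurable functions of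
the matrix, the norms of `sin Θ` are continuous functions of the estimator. -/
theorem aestronglyMeasurable_sinTheta {V : Matrix (Fin p) (Fin r) ℝ} (hV : Vᵀ * V = 1)
    {W : Ω → Matrix (Fin p) (Fin r) ℝ} (hWm : ∀ i k, AEMeasurable (fun ω => W ω i k) μ)
    (hW : ∀ᵐ ω ∂μ, (W ω)ᵀ * W ω = 1) :
    AEStronglyMeasurable (fun ω => specNorm (sinTheta V (W ω)) ^ 2) μ ∧
      AEStronglyMeasurable (fun ω => frobNorm (sinTheta V (W ω)) ^ 2) μ := by
  have hm : AEMeasurable (fun ω i k => W ω i k) μ :=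
    aemeasurable_pi_lambda _ fun i => aemeasurable_pi_lambda _ fun k => hWm i k
  constructor
  · have hc : Continuous fun M : Fin p → Fin r → ℝ =>
        specNorm (Matrix.of M - V * (Vᵀ * Matrix.of M)) ^ 2 := by
      have h : Continuous fun M : Matrix (Fin p) (Fin r) ℝ => M - V * (Vᵀ * M) := by fun_prop
      exact (continuous_specNorm.comp h).pow 2
    refine (hc.measurable.comp_aemeasurable hm).aestronglyMeasurable.congr ?_
    filter_upwards [hW] with ω hω
    rw [specNorm_sinTheta hV hω]
    rfl
  · have hc : Continuous fun M : Fin p → Fin r → ℝ =>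
        frobNorm (Matrix.of M - V * (Vᵀ * Matrix.of M)) ^ 2 := by
      have h : Continuous fun M : Matrix (Fin p) (Fin r) ℝ => M - V * (Vᵀ * M) := by fun_prop
      simp_rw [frobNorm_sq]
      refine continuous_finsetSum _ fun i _ => continuous_finsetSum _ fun j _ => ?_
      exact (h.matrix_elem i j).pow 2
    refine (hc.measurable.comp_aemeasurable hm).aestronglyMeasurable.congr ?_
    filter_upwards [hW] with ω hω
    rw [frobNorm_sinTheta_sq hV hω]
    rfl

end PrincipalAngles

/-! ### The risk bound -/

section Risk

/-- The loss is controlled by the noise parameters `g₁ = α²` and `g₂ = δ²` without any smallness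
assumption, because the right-hand side exceeds `1` as soon as one of them is large. -/
theorem specNorm_sinTheta_sq_le {m n r : ℕ} (hr : 1 ≤ r) {X A : Matrix (Fin m) (Fin n) ℝ}
    {U : Matrix (Fin m) (Fin r) ℝ} {V : Matrix (Fin n) (Fin r) ℝ} (hU : Uᵀ * U = 1)
    (hV : Vᵀ * V = 1) {d : Fin r → ℝ} (hX : X = U * Matrix.diagonal d * Vᵀ)
    {σ : ℝ} (hσ : 0 < σ) (hd : ∀ k, σ ≤ d k)
    {U₀ : Matrix (Fin m) (Fin m) ℝ} (hU₀ : U₀ ∈ Matrix.orthogonalGroup (Fin m) ℝ)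
    {V₀ : Matrix (Fin n) (Fin n) ℝ} (hV₀ : V₀ ∈ Matrix.orthogonalGroup (Fin n) ℝ)
    {s : ℕ → ℝ} (hs : Antitone s) (hs0 : ∀ k, 0 ≤ s k) (hm : r ≤ m) (hn : r ≤ n)
    (hY : X + A = U₀ * rectDiagonal m n s * V₀ᵀ) {g₁ g₂ : ℝ} (hg₁ : 0 ≤ g₁) (hg₂ : 0 ≤ g₂)
    (hα : ∀ y x, |⟪Matrix.toEuclideanLin U y, Matrix.toEuclideanLin A x⟫| ≤ √g₁ * ‖y‖ * ‖x‖)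
    (hδ : ∀ x y, |⟪Matrix.toEuclideanLin A x, Matrix.toEuclideanLin A y⟫ - m * ⟪x, y⟫| ≤
      √g₂ * ‖x‖ * ‖y‖) :
    specNorm (sinTheta V (V₀.submatrix id (Fin.castLE hn))) ^ 2 ≤
      64 * (g₁ * (σ ^ 2 + m) + g₂) / σ ^ 4 := by
  have hm0 : (0 : ℝ) ≤ m := Nat.cast_nonneg m
  have hσ4 : 0 < σ ^ 4 := by positivity
  by_cases hα1 : √g₁ ≤ σ / 8
  swap
  · refine (specNorm_sinTheta_sq_le_one _ _).trans ((le_div_iff₀ hσ4).2 ?_)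
    have h1 : (σ / 8) ^ 2 ≤ g₁ := by
      rw [← Real.sq_sqrt hg₁]; exact pow_le_pow_left₀ (by positivity) (not_le.1 hα1).le 2
    have h2 : (σ / 8) ^ 2 * (σ ^ 2 + m) ≤ g₁ * (σ ^ 2 + m) := by gcongr
    nlinarith [mul_nonneg (sq_nonneg σ) hm0]
  by_cases hδ1 : √g₂ ≤ σ ^ 2 / 8
  swap
  · refine (specNorm_sinTheta_sq_le_one _ _).trans ((le_div_iff₀ hσ4).2 ?_)
    have h1 : (σ ^ 2 / 8) ^ 2 ≤ g₂ := by
      rw [← Real.sq_sqrt hg₂]; exact pow_le_pow_left₀ (by positivity) (not_le.1 hδ1).le 2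
    have h2 : 0 ≤ g₁ * (σ ^ 2 + m) := by positivity
    nlinarith
  have hW := transpose_submatrix_mul_self hV₀ hn
  have hmain := norm_sub_proj_le hr hU hV hX hσ hd hU₀ hV₀ hs hs0 hm hn hY
    (Real.sqrt_nonneg g₁) (Real.sqrt_nonneg g₂) hα1 hδ1 hα hδ
  rw [specNorm_sinTheta hV hW]
  set lam : ℝ := m + σ ^ 2 / 2 with hlam
  have hlam0 : 0 ≤ lam := by positivity
  have h1 : specNorm (V₀.submatrix id (Fin.castLE hn) -
      V * (Vᵀ * V₀.submatrix id (Fin.castLE hn))) ≤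
      (2 * √g₁ * √lam + √g₂) / (σ ^ 2 / 2) :=
    specNorm_le (by positivity) fun x => by
      rw [div_mul_eq_mul_div, le_div_iff₀ (by positivity)]
      exact hmain x
  calc _ ≤ ((2 * √g₁ * √lam + √g₂) / (σ ^ 2 / 2)) ^ 2 :=
        pow_le_pow_left₀ (specNorm_nonneg _) h1 2
    _ = 4 * (2 * √g₁ * √lam + √g₂) ^ 2 / σ ^ 4 := by field_simp; ring
    _ ≤ 64 * (g₁ * (σ ^ 2 + m) + g₂) / σ ^ 4 := by
        gcongr ?_ / _
        have h2 : (2 * √g₁ * √lam + √g₂) ^ 2 ≤ 2 * (4 * g₁ * lam) + 2 * g₂ := by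
          have h3 : (2 * √g₁ * √lam) ^ 2 = 4 * g₁ * lam := by
            rw [mul_pow, mul_pow, Real.sq_sqrt hg₁, Real.sq_sqrt hlam0]; norm_num
          have h4 := Real.sq_sqrt hg₂
          nlinarith [sq_nonneg (2 * √g₁ * √lam - √g₂)]
        have h5 : g₁ * lam ≤ g₁ * (σ ^ 2 + m) := by
          gcongr
          rw [hlam]; nlinarith [sq_nonneg σ]
        have h6 : 0 ≤ g₁ * (σ ^ 2 + m) := by positivity
        nlinarith

/-- The risk bound for the leading right singular vectors. The bound for the left ones follows by
transposition. -/
theorem exists_risk_bound {τ : ℝ} (hτ : 0 < τ) :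
    ∃ C : ℝ, 0 < C ∧
      ∀ (m n r : ℕ) (_hr : 1 ≤ r) (X : Matrix (Fin m) (Fin n) ℝ)
        (U : Matrix (Fin m) (Fin r) ℝ) (V : Matrix (Fin n) (Fin r) ℝ)
        (_hU : Uᵀ * U = 1) (_hV : Vᵀ * V = 1) (d : Fin r → ℝ)
        (_hX : X = U * Matrix.diagonal d * Vᵀ) (σ : ℝ) (_hσ : 0 < σ) (_hd : ∀ k, σ ≤ d k)
        (Ω : Type*) (_ : MeasurableSpace Ω) (μ : Measure Ω) (_ : IsProbabilityMeasure μ)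
        (ν : Measure ℝ) (_hν : IsStdSubGaussian τ ν)
        (Z : Fin m → Fin n → Ω → ℝ)
        (_hlaw : ∀ i j, HasLaw (Z i j) ν μ)
        (_hindep : iIndepFun (fun ij : Fin m × Fin n => Z ij.1 ij.2) μ)
        (W : Ω → Matrix (Fin n) (Fin r) ℝ)
        (_hWm : ∀ j k, AEMeasurable (fun ω => W ω j k) μ)
        (_hsvd : ∀ᵐ ω ∂μ, ∃ (_hm : r ≤ m) (hn : r ≤ n),
          ∃ U₀ ∈ Matrix.orthogonalGroup (Fin m) ℝ, ∃ V₀ ∈ Matrix.orthogonalGroup (Fin n) ℝ,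
          ∃ s : ℕ → ℝ, Antitone s ∧ (∀ k, 0 ≤ s k) ∧
            X + Matrix.of (fun i j => Z i j ω) = U₀ * rectDiagonal m n s * V₀ᵀ ∧
            W ω = V₀.submatrix id (Fin.castLE hn)),
        (Integrable (fun ω => specNorm (sinTheta V (W ω)) ^ 2) μ ∧
          ∫ ω, specNorm (sinTheta V (W ω)) ^ 2 ∂μ ≤
            min (C * n * (σ ^ 2 + m) / σ ^ 4) 1) ∧
        (Integrable (fun ω => frobNorm (sinTheta V (W ω)) ^ 2) μ ∧
          ∫ ω, frobNorm (sinTheta V (W ω)) ^ 2 ∂μ ≤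
            min (C * n * r * (σ ^ 2 + m) / σ ^ 4) r) := by
  obtain ⟨c, hc⟩ : ∃ c : ℝ, c = 1 / (16 * τ) := ⟨_, rfl⟩
  set C₁ : ℝ := 16 * (2 * (50 + τ) ^ 2 + 4) with hC₁
  set C₂ : ℝ := 64 * (2 * (50 + 4 * Real.exp (2 * c)) ^ 2 + 4) / c ^ 2 with hC₂
  have hC₁0 : 0 ≤ C₁ := by positivity
  have hC₂0 : 0 ≤ C₂ := by positivity
  refine ⟨64 * (C₁ + C₂) + 1, by positivity, ?_⟩
  intro m n r hr X U V hU hV d hX σ hσ hd Ω _ μ _ ν hν Z hlaw hindep W hWm hsvd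
  obtain ⟨_, hm, hn, -⟩ := hsvd.exists
  have hn1 : 1 ≤ n := hr.trans hn
  have hn0 : (0 : ℝ) ≤ n := Nat.cast_nonneg n
  have hm0 : (0 : ℝ) ≤ m := Nat.cast_nonneg m
  have hσ4 : 0 < σ ^ 4 := by positivity
  obtain ⟨g₁, hg₁i, hg₁0, hg₁e, hg₁⟩ := exists_dominating_compression hτ hν hlaw hindep hn1 hn
    (isometryOfOrthonormal U hU)
  obtain ⟨g₂, hg₂i, hg₂0, hg₂e, hg₂⟩ := exists_dominating_covariance hτ hν hlaw hindep hn1 hc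
  have hWo : ∀ᵐ ω ∂μ, (W ω)ᵀ * W ω = 1 := by
    filter_upwards [hsvd] with ω ⟨_, hn, U₀, _, V₀, hV₀, s, _, _, _, hW⟩
    rw [hW]; exact transpose_submatrix_mul_self hV₀ hn
  obtain ⟨hms, hmf⟩ := aestronglyMeasurable_sinTheta hV hWm hWo
  have hsi : Integrable (fun ω => specNorm (sinTheta V (W ω)) ^ 2) μ := by
    refine Integrable.of_bound hms 1 (Filter.Eventually.of_forall fun ω => ?_)
    rw [Real.norm_of_nonneg (sq_nonneg _)]
    exact specNorm_sinTheta_sq_le_one _ _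
  have hfr : ∀ ω, frobNorm (sinTheta V (W ω)) ^ 2 ≤ r * specNorm (sinTheta V (W ω)) ^ 2 :=
    fun ω => frobNorm_sinTheta_sq_le _ _
  have hfi : Integrable (fun ω => frobNorm (sinTheta V (W ω)) ^ 2) μ := by
    refine (hsi.const_mul (r : ℝ)).mono' hmf (Filter.Eventually.of_forall fun ω => ?_)
    rw [Real.norm_of_nonneg (sq_nonneg _)]
    exact hfr ω
  have hone : ∫ ω, specNorm (sinTheta V (W ω)) ^ 2 ∂μ ≤ 1 := by
    refine (integral_mono hsi (integrable_const 1)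
      fun ω => specNorm_sinTheta_sq_le_one _ _).trans_eq ?_
    simp
  have hpt : ∀ᵐ ω ∂μ, specNorm (sinTheta V (W ω)) ^ 2 ≤
      64 * (g₁ ω * (σ ^ 2 + m) + g₂ ω) / σ ^ 4 := by
    filter_upwards [hsvd] with ω ⟨hm, hn, U₀, hU₀, V₀, hV₀, s, hs, hs0, hY, hW⟩
    rw [hW]
    exact specNorm_sinTheta_sq_le hr hU hV hX hσ hd hU₀ hV₀ hs hs0 hm hn hY (hg₁0 ω) (hg₂0 ω)
      (hg₁ ω) (hg₂ ω)
  have hgi : Integrable (fun ω => 64 * (g₁ ω * (σ ^ 2 + m) + g₂ ω) / σ ^ 4) μ :=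
    (((hg₁i.mul_const _).add hg₂i).const_mul _).div_const _
  have hbound : ∫ ω, specNorm (sinTheta V (W ω)) ^ 2 ∂μ ≤
      (64 * (C₁ + C₂) + 1) * n * (σ ^ 2 + m) / σ ^ 4 := by
    rcases le_total (n : ℝ) (σ ^ 2) with hnσ | hnσ
    · refine (integral_mono_ae hsi hgi hpt).trans ?_
      rw [integral_div, integral_const_mul, integral_add (hg₁i.mul_const _) hg₂i,
        integral_mul_const]
      gcongr ?_ / _
      have h1 : (∫ ω, g₁ ω ∂μ) * (σ ^ 2 + m) ≤ C₁ * n * (σ ^ 2 + m) := by gcongr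
      have h2 : ∫ ω, g₂ ω ∂μ ≤ C₂ * n * (σ ^ 2 + m) := by
        calc ∫ ω, g₂ ω ∂μ ≤ C₂ * (n ^ 2 + n * m) := hg₂e
          _ = C₂ * n * (n + m) := by ring
          _ ≤ _ := by gcongr
      have h3 : 0 ≤ n * (σ ^ 2 + m) := by positivity
      linarith
    · -- For `n ≥ σ²` the claimed bound exceeds `1`.
      refine hone.trans ((le_div_iff₀ hσ4).2 ?_)
      have h1 : σ ^ 2 * σ ^ 2 ≤ n * (σ ^ 2 + m) := by
        gcongr; linarith
      have h2 : 0 ≤ 64 * (C₁ + C₂) * (n * (σ ^ 2 + m)) := by positivity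
      nlinarith
  refine ⟨⟨hsi, le_min hbound hone⟩, hfi, ?_⟩
  have hf : ∫ ω, frobNorm (sinTheta V (W ω)) ^ 2 ∂μ ≤
      r * ∫ ω, specNorm (sinTheta V (W ω)) ^ 2 ∂μ := by
    rw [← integral_const_mul]
    exact integral_mono hfi (hsi.const_mul _) hfr
  refine le_min (hf.trans ?_) (hf.trans (mul_le_of_le_one_right (Nat.cast_nonneg r) hone))
  calc r * ∫ ω, specNorm (sinTheta V (W ω)) ^ 2 ∂μ ≤
        r * ((64 * (C₁ + C₂) + 1) * n * (σ ^ 2 + m) / σ ^ 4) := by gcongr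
    _ = _ := by ring

end Risk

/-! ### Singular values of the signal -/

section SingularValues

variable {m n : ℕ}

theorem sigma_nonneg (A : Matrix (Fin m) (Fin n) ℝ) (k : ℕ) : 0 ≤ sigma A k :=
  LinearMap.singularValues_nonneg _ _

theorem sigma_antitone (A : Matrix (Fin m) (Fin n) ℝ) : Antitone (sigma A) := fun _ _ h =>
  LinearMap.singularValues_antitone _ (Nat.sub_le_sub_right h 1)

theorem sigma_rank_pos (A : Matrix (Fin m) (Fin n) ℝ) (hA : 1 ≤ A.rank) : 0 < sigma A A.rank := by
  rw [sigma, LinearMap.singularValues_pos_iff_lt_finrank_range]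
  have : A.rank = Module.finrank ℝ (Matrix.toEuclideanLin A).range := by
    rw [Matrix.toEuclideanLin, Matrix.toLpLin_eq_toLin, ← Matrix.rank_eq_finrank_range_toLin]
  omega

theorem sigmaMatrix_eq_rectDiagonal (A : Matrix (Fin m) (Fin n) ℝ) :
    sigmaMatrix A = rectDiagonal m n fun k => sigma A (k + 1) := rfl

end SingularValues

end SingularSubspace

theorem theorem3 (τ : ℝ) (hτ : 0 < τ) :
    ∃ C : ℝ, 0 < C ∧
      ∀ (p₁ p₂ r : ℕ) (_hr : 1 ≤ r)
        (X : Matrix (Fin p₁) (Fin p₂) ℝ) (_hrank : X.rank = r)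
        (U : Matrix (Fin p₁) (Fin r) ℝ) (V : Matrix (Fin p₂) (Fin r) ℝ)
        (_hU : Uᵀ * U = 1) (_hV : Vᵀ * V = 1)
        (_hX : X = U * Matrix.diagonal (fun k : Fin r => sigma X (k.val + 1)) * Vᵀ)
        (Ω : Type*) (_ : MeasurableSpace Ω) (μ : Measure Ω) (_ : IsProbabilityMeasure μ)
        (ν : Measure ℝ) (_hν : IsStdSubGaussian τ ν)
        (Z : Fin p₁ → Fin p₂ → Ω → ℝ)
        (_hlaw : ∀ i j, HasLaw (Z i j) ν μ)
        (_hindep : iIndepFun (fun ij : Fin p₁ × Fin p₂ => Z ij.1 ij.2) μ)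
        (Uhat : Ω → Matrix (Fin p₁) (Fin r) ℝ) (Vhat : Ω → Matrix (Fin p₂) (Fin r) ℝ)
        (_hUm : ∀ i k, AEMeasurable (fun ω => Uhat ω i k) μ)
        (_hVm : ∀ j k, AEMeasurable (fun ω => Vhat ω j k) μ)
        (_hhat : ∀ᵐ ω ∂μ, IsLeadingSingularVectors
          (X + Matrix.of (fun i j => Z i j ω)) (Uhat ω) (Vhat ω)),
        (Integrable (fun ω => specNorm (sinTheta V (Vhat ω)) ^ 2) μ ∧
          ∫ ω, specNorm (sinTheta V (Vhat ω)) ^ 2 ∂μ ≤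
            min (C * p₂ * (sigma X r ^ 2 + p₁) / sigma X r ^ 4) 1) ∧
        (Integrable (fun ω => frobNorm (sinTheta V (Vhat ω)) ^ 2) μ ∧
          ∫ ω, frobNorm (sinTheta V (Vhat ω)) ^ 2 ∂μ ≤
            min (C * p₂ * r * (sigma X r ^ 2 + p₁) / sigma X r ^ 4) r) ∧
        (Integrable (fun ω => specNorm (sinTheta U (Uhat ω)) ^ 2) μ ∧
          ∫ ω, specNorm (sinTheta U (Uhat ω)) ^ 2 ∂μ ≤
            min (C * p₁ * (sigma X r ^ 2 + p₂) / sigma X r ^ 4) 1) ∧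
        (Integrable (fun ω => frobNorm (sinTheta U (Uhat ω)) ^ 2) μ ∧
          ∫ ω, frobNorm (sinTheta U (Uhat ω)) ^ 2 ∂μ ≤
            min (C * p₁ * r * (sigma X r ^ 2 + p₂) / sigma X r ^ 4) r) := by
  obtain ⟨C, hC, hmain⟩ := exists_risk_bound hτ
  refine ⟨C, hC, ?_⟩
  intro p₁ p₂ r hr X hrank U V hU hV hX Ω _ μ _ ν hν Z hlaw hindep Uhat Vhat hUm hVm hhat
  have hσ : 0 < sigma X r := by
    rw [← hrank]; exact sigma_rank_pos X (hrank ▸ hr)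
  have hd : ∀ k : Fin r, sigma X r ≤ sigma X (k.val + 1) := fun k => sigma_antitone X k.isLt
  have hanti : ∀ Y : Matrix (Fin p₁) (Fin p₂) ℝ, Antitone fun k => sigma Y (k + 1) :=
    fun Y _ _ h => sigma_antitone Y (Nat.add_le_add_right h 1)
  have hright := hmain p₁ p₂ r hr X U V hU hV _ hX (sigma X r) hσ hd Ω _ μ ‹_› ν hν Z hlaw hindep
    Vhat hVm (by
      filter_upwards [hhat] with ω ⟨hm, hn, U₀, hU₀, V₀, hV₀, hY, _, hW⟩
      exact ⟨hm, hn, U₀, hU₀, V₀, hV₀, _, hanti _, fun k => sigma_nonneg _ _, hY, hW⟩)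
  have hXt : Xᵀ = V * Matrix.diagonal (fun k : Fin r => sigma X (k.val + 1)) * Uᵀ := by
    conv_lhs => rw [hX]
    rw [Matrix.transpose_mul, Matrix.transpose_mul, Matrix.transpose_transpose,
      Matrix.diagonal_transpose, Matrix.mul_assoc]
  have hleft := hmain p₂ p₁ r hr Xᵀ V U hV hU _ hXt (sigma X r) hσ hd Ω _ μ ‹_› ν hν
    (fun j i => Z i j) (fun j i => hlaw i j)
    (hindep.precomp (g := Prod.swap) Prod.swap_injective) Uhat hUm (by
      filter_upwards [hhat] with ω ⟨hm, hn, U₀, hU₀, V₀, hV₀, hY, hW, _⟩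
      refine ⟨hn, hm, V₀, hV₀, U₀, hU₀, _,
        hanti (X + Matrix.of fun i j => Z i j ω), fun k => sigma_nonneg _ _, ?_, hW⟩
      rw [← transpose_svd, ← sigmaMatrix_eq_rectDiagonal, ← hY, Matrix.transpose_add]
      rfl)
  exact ⟨hright.1, hright.2, hleft.1, hleft.2⟩
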